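/- Let $K\ge 1$, $a_0<\dots<a_K$, $I=[a_0,a_K]$. For $k=1,\dots,K$ let $m_k:[a_{k-1},a_k]\to\mathbb{R}$ be $\mathcal{C}^1$ and let $\mathbf{k}_k:[a_{k-1},a_k]^2\to\mathbb{R}$ be a $\mathcal{C}^3$ symmetric positive definite function (all Gram matrices positive semidefinite). For a kernel $\mathbf k$ and a function $m$ put $$\mathbf{K}_{u;v}=\begin{bmatrix}\mathbf{k}(u,v)&\frac{\partial\mathbf{k}}{\partial y}(u,v)\\ \frac{\partial\mathbf{k}}{\partial x}(u,v)&\frac{\partial^2\mathbf{k}}{\partial x\partial y}(u,v)\end{bmatrix},\qquad \mathbf{M}_u=\begin{bmatrix}m(u)\\ m'(u)\end{bmatrix},$$ and write ${}_k\mathbf{K}_{u;v}$, ${}_k\mathbf{M}_u$ for these objects formed with $\mathbf{k}_k$ and $m_k$. Suppose that $\mathbf{k}_k$ is neither degenerate at $a_{k-1}$ nor degenerate at $a_k$ given $a_{k-1}$, i.e. that ${}_k\mathbf{K}_{a_{k-1};a_{k-1}}$ and $${}_k\mathbf{G}:=\begin{bmatrix}{}_k\mathbf{K}_{a_{k-1};a_{k-1}}&{}_k\mathbf{K}_{a_{k-1};a_k}\\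 {}_k\mathbf{K}_{a_k;a_{k-1}}&{}_k\mathbf{K}_{a_k;a_k}\end{bmatrix}$$ are invertible. A derivative Gaussian process (DGP) with mean function $m$ and covariance function $\mathbf{k}$ is an $\mathbb{R}^2$-valued process whose finite-dimensional laws are Gaussian with mean $\mathbf{M}_u$ at time $u$ and covariance $\mathbf{K}_{u;v}$ between times $u$ and $v$. Let $(SD_t)_{t\in I}$, $SD_t=(z_t,z'_t)$, be a string derivative Gaussian process on a probability space, that is, an $\mathbb{R}^2$-valued process such that: 1. $(SD_{a_0},\dots,SD_{a_K})$ has the density $(x_0,\dots,x_K)\mapsto\prod_{k=0}^K p_{\mathcal N}(x_k;\mu_k^b,\Sigma_k^b)$, where $p_{\mathcal N}(\cdot\,;\mu,\Sigma)$ is the density of the Gaussian law with mean $\mu$ and covariance $\Sigma$, $\mu^b_0={}_1\mathbf{M}_{a_0}$, $\Sigma^b_0={}_1\mathbf{K}_{a_0;a_0}$, and for $k\ge1$ $$\mu^b_k={}_k\mathbf{M}_{a_k}+{}_k\mathbf{K}_{a_k;a_{k-1}}\,{}_k\mathbf{K}_{a_{k-1};a_{k-1}}^{-1}(x_{k-1}-{}_k\mathbf{M}_{a_{k-1}}),\quad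 \Sigma^b_k={}_k\mathbf{K}_{a_k;a_k}-{}_k\mathbf{K}_{a_k;a_{k-1}}\,{}_k\mathbf{K}_{a_{k-1};a_{k-1}}^{-1}\,{}_k\mathbf{K}_{a_k;a_{k-1}}^T.$$ 2. Conditionally on $(SD_{a_k}=x_k)_{0\le k\le K}$, the restrictions $(SD_t)_{t\in\,]a_{k-1},a_k[}$, $1\le k\le K$, are independent, and the $k$-th one is the DGP with mean and covariance functions $$m_c(t)=m_k(t)+r_t\,{}_k\mathbf{G}^{-1}\begin{bmatrix}x_{k-1}-{}_k\mathbf{M}_{a_{k-1}}\\ x_k-{}_k\mathbf{M}_{a_k}\end{bmatrix},\qquad \mathbf{k}_c(t,s)=\mathbf{k}_k(t,s)-r_t\,{}_k\mathbf{G}^{-1}r_s^T,$$ where $r_t=\begin{bmatrix}\mathbf{k}_k(t,a_{k-1})&\frac{\partial\mathbf{k}_k}{\partial y}(t,a_{k-1})&\mathbf{k}_k(t,a_k)&\frac{\partial\mathbf{k}_k}{\partial y}(t,a_k)\end{bmatrix}$. Let $k_{SGP}(u,v)=\mathrm{cov}(z_u,z_v)$ be the string GP kernel and let $\bar{\mathbf{K}}_{u;v}$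 be the $2\times2$ matrix of the covariances between $(z_u,z'_u)$ and $(z_v,z'_v)$. Put $${}^b_kM={}_k\mathbf{K}_{a_k;a_{k-1}}\,{}_k\mathbf{K}_{a_{k-1};a_{k-1}}^{-1},\quad {}^b_k\Sigma={}_k\mathbf{K}_{a_k;a_k}-{}^b_kM\,{}_k\mathbf{K}_{a_{k-1};a_k},\quad {}_l\Lambda_x=\begin{bmatrix}{}_l\mathbf{K}_{x;a_{l-1}}&{}_l\mathbf{K}_{x;a_l}\end{bmatrix}{}_l\mathbf{G}^{-1}.$$ Then all $z_t,z'_t$ with $t\in I$ are square integrable, and the following hold. (0) For $u,v\in I$, the partial derivatives below exist (within $I$) and $$\bar{\mathbf{K}}_{u;v}=\begin{bmatrix}k_{SGP}(u,v)&\frac{\partial k_{SGP}}{\partial v}(u,v)\\ \frac{\partial k_{SGP}}{\partial u}(u,v)&\frac{\partial^2k_{SGP}}{\partial u\partial v}(u,v)\end{bmatrix}=\bar{\mathbf{K}}_{v;u}^T.$$ (1) $\bar{\mathbf{K}}_{a_0;a_0}={}_1\mathbf{K}_{a_0;a_0}$, $\bar{\mathbf{K}}_{a_1;a_1}={}_1\mathbf{K}_{a_1;a_1}$,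 $\bar{\mathbf{K}}_{a_0;a_1}={}_1\mathbf{K}_{a_0;a_1}$. (2) For $1\le k\le K$: $\bar{\mathbf{K}}_{a_k;a_k}={}^b_k\Sigma+{}^b_kM\,\bar{\mathbf{K}}_{a_{k-1};a_{k-1}}\,{}^b_kM^T$. (3) For $0\le l<k\le K$: $\bar{\mathbf{K}}_{a_k;a_l}={}^b_kM\,\bar{\mathbf{K}}_{a_{k-1};a_l}$. (4) For $1\le p,q\le K$, $u\in[a_{p-1},a_p]$ and $v\in[a_{q-1},a_q]$, the conditional covariance matrix ${}_c\bar{\mathbf{K}}_{u;v}$ of $(z_u,z'_u)$ and $(z_v,z'_v)$ given $SD_{a_{p-1}},SD_{a_p},SD_{a_{q-1}},SD_{a_q}$ is almost surely the constant matrix $${}_c\bar{\mathbf{K}}_{u;v}=0\ \text{ if }p\ne q,\qquad {}_c\bar{\mathbf{K}}_{u;v}={}_p\mathbf{K}_{u;v}-{}_p\Lambda_u\begin{bmatrix}{}_p\mathbf{K}_{v;a_{p-1}}^T\\ {}_p\mathbf{K}_{v;a_p}^T\end{bmatrix}\ \text{ if }p=q,$$ and $$\bar{\mathbf{K}}_{u;v}={}_c\bar{\mathbf{K}}_{u;v}+{}_p\Lambda_u\begin{bmatrix}\bar{\mathbf{K}}_{a_{p-1};a_{q-1}}&\bar{\mathbf{K}}_{a_{p-1};a_q}\\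 \bar{\mathbf{K}}_{a_p;a_{q-1}}&\bar{\mathbf{K}}_{a_p;a_q}\end{bmatrix}{}_q\Lambda_v^T.$$ -/

import Mathlib

open MeasureTheory ProbabilityTheory Set Matrix

noncomputable section

namespace StringGP

/-! ### Kernels and derivative Gaussian processes on an interval `S`

Functions on `S` (or on `S × S`) are represented by functions on `ℝ` (or on `ℝ × ℝ`), of which only
the values on `S` (or on `S × S`) are used; derivatives are taken within `S`, hence are one-sided
at the end points of a compact interval. -/

/-- `κ` is a symmetric positive definite function on `S × S`, in the usual sense of covariance
functions: every Gram matrix is positive semidefinite. -/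
def IsCovKernelOn (κ : ℝ → ℝ → ℝ) (S : Set ℝ) : Prop :=
  (∀ x ∈ S, ∀ y ∈ S, κ x y = κ y x) ∧
  ∀ (n : ℕ) (t : Fin n → ℝ), (∀ i, t i ∈ S) → ∀ c : Fin n → ℝ,
    0 ≤ ∑ i, ∑ j, c i * c j * κ (t i) (t j)

/-- The partial derivative `∂κ/∂x (u, v)`. -/
def partialX (κ : ℝ → ℝ → ℝ) (S : Set ℝ) (u v : ℝ) : ℝ :=
  derivWithin (fun x => κ x v) S u

/-- The partial derivative `∂κ/∂y (u, v)`. -/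
def partialY (κ : ℝ → ℝ → ℝ) (S : Set ℝ) (u v : ℝ) : ℝ :=
  derivWithin (fun y => κ u y) S v

/-- The mixed partial derivative `∂²κ/∂x∂y (u, v)`. -/
def partialXY (κ : ℝ → ℝ → ℝ) (S : Set ℝ) (u v : ℝ) : ℝ :=
  derivWithin (fun x => partialY κ S x v) S u

/-- The `2 × 2` matrix `K_{u;v}` of a kernel and its partial derivatives. -/
def kerMat (κ : ℝ → ℝ → ℝ) (S : Set ℝ) (u v : ℝ) : Matrix (Fin 2) (Fin 2) ℝ :=
  !![κ u v, partialY κ S u v; partialX κ S u v, partialXY κ S u v]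

/-- The vector `M_u = (m(u), m'(u))`. -/
def meanVec (m : ℝ → ℝ) (S : Set ℝ) (u : ℝ) : Fin 2 → ℝ :=
  ![m u, derivWithin m S u]

/-- The `4 × 4` matrix `K_{(a,b);(a,b)}`, in `2 × 2` blocks. -/
def kerMatPair (κ : ℝ → ℝ → ℝ) (S : Set ℝ) (a b : ℝ) :
    Matrix (Fin 2 ⊕ Fin 2) (Fin 2 ⊕ Fin 2) ℝ :=
  Matrix.fromBlocks (kerMat κ S a a) (kerMat κ S a b) (kerMat κ S b a) (kerMat κ S b b)

/-- `κ` is degenerate at `a`: the Gaussian vector `(z_a, z'_a)` of a derivative Gaussian process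
with kernel `κ` is degenerate, that is, its covariance matrix is singular. -/
def DegenerateAt (κ : ℝ → ℝ → ℝ) (S : Set ℝ) (a : ℝ) : Prop :=
  (kerMat κ S a a).det = 0

/-- `κ` is degenerate at `b` given `a`: the Gaussian vector `(z_a, z'_a)` is not degenerate but
`(z_a, z'_a, z_b, z'_b)` is. -/
def DegenerateAtGiven (κ : ℝ → ℝ → ℝ) (S : Set ℝ) (b a : ℝ) : Prop :=
  ¬ DegenerateAt κ S a ∧ (kerMatPair κ S a b).det = 0

/-- `ν` is the law at the times `t 0, …, t (n - 1)` of a derivative Gaussian process on `S` with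
mean function `m` and covariance function `κ`: it is Gaussian, with mean given by `(m, m')` and
covariance given by `κ` and its partial derivatives. The coordinate `y i 0` stands for `z_{t i}`
and `y i 1` for `z'_{t i}`. -/
def IsDGPLaw (m : ℝ → ℝ) (κ : ℝ → ℝ → ℝ) (S : Set ℝ) {n : ℕ} (t : Fin n → ℝ)
    (ν : Measure (Fin n → Fin 2 → ℝ)) : Prop :=
  IsGaussian ν ∧
  (∀ i c, ∫ y, y i c ∂ν = meanVec m S (t i) c) ∧
  (∀ i j c d, cov[fun y => y i c, fun y => y j d; ν] = kerMat κ S (t i) (t j) c d)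

/-- The row `[K̃_{t;a}, K̃_{t;b}] = [κ(t,a), ∂κ/∂y (t,a), κ(t,b), ∂κ/∂y (t,b)]`. -/
def kerRow (κ : ℝ → ℝ → ℝ) (S : Set ℝ) (a b t : ℝ) : Fin 2 ⊕ Fin 2 → ℝ :=
  Sum.elim ![κ t a, partialY κ S t a] ![κ t b, partialY κ S t b]

/-- Mean function of the conditional derivative Gaussian process on `[a, b]` that is conditioned
to take the value `xa` at `a` and the value `xb` at `b`. -/
def condMean (m : ℝ → ℝ) (κ : ℝ → ℝ → ℝ) (a b : ℝ) (xa xb : Fin 2 → ℝ) (t : ℝ) : ℝ :=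
  m t + kerRow κ (Icc a b) a b t ⬝ᵥ ((kerMatPair κ (Icc a b) a b)⁻¹ *ᵥ
    Sum.elim (xa - meanVec m (Icc a b) a) (xb - meanVec m (Icc a b) b))

/-- Covariance function of the conditional derivative Gaussian process on `[a, b]`. -/
def condKer (κ : ℝ → ℝ → ℝ) (a b : ℝ) (t s : ℝ) : ℝ :=
  κ t s - kerRow κ (Icc a b) a b t ⬝ᵥ ((kerMatPair κ (Icc a b) a b)⁻¹ *ᵥ
    kerRow κ (Icc a b) a b s)

/-- The Gaussian density `p_N(x; μ, C)` in dimension `d`. -/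
def gaussianDensity {d : ℕ} (x μ : Fin d → ℝ) (C : Matrix (Fin d) (Fin d) ℝ) : ℝ :=
  (√((2 * Real.pi) ^ d * C.det))⁻¹ * Real.exp (-(1 / 2) * ((x - μ) ⬝ᵥ (C⁻¹ *ᵥ (x - μ))))

/-! ### String Gaussian processes -/

/-- The parameters of a string GP with `K` strings. The string with index `k : Fin K` lives on
`[time k.castSucc, time k.succ]`; it is the string number `k + 1` when strings are counted
from `1`. -/
structure Params (K : ℕ) where
  /-- the boundary times `a_0 < ⋯ < a_K` -/
  time : Fin (K + 1) → ℝ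
  /-- the unconditional mean functions -/
  mean : Fin K → ℝ → ℝ
  /-- the unconditional kernels -/
  ker : Fin K → ℝ → ℝ → ℝ
  time_strictMono : StrictMono time
  mean_contDiffOn : ∀ k, ContDiffOn ℝ 1 (mean k) (Icc (time k.castSucc) (time k.succ))
  ker_contDiffOn : ∀ k, ContDiffOn ℝ 3 (fun x : ℝ × ℝ => ker k x.1 x.2)
    (Icc (time k.castSucc) (time k.succ) ×ˢ Icc (time k.castSucc) (time k.succ))
  ker_isCovKernelOn : ∀ k, IsCovKernelOn (ker k) (Icc (time k.castSucc) (time k.succ))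
  ker_not_degenerateAt : ∀ k, ¬ DegenerateAt (ker k) (Icc (time k.castSucc) (time k.succ))
    (time k.castSucc)
  ker_not_degenerateAtGiven : ∀ k, ¬ DegenerateAtGiven (ker k)
    (Icc (time k.castSucc) (time k.succ)) (time k.succ) (time k.castSucc)

namespace Params

variable {K : ℕ} (s : Params K)

/-- The left boundary time of a string. -/
def left (k : Fin K) : ℝ := s.time k.castSucc

/-- The right boundary time of a string. -/
def right (k : Fin K) : ℝ := s.time k.succ

/-- The closed interval on which a string lives. -/
def seg (k : Fin K) : Set ℝ := Icc (s.left k) (s.right k)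

/-- The index interval `I = [a_0, a_K]`. -/
def dom : Set ℝ := Icc (s.time 0) (s.time (Fin.last K))

/-- The matrix `ₖK_{u;v}` of the kernel of a string and its partial derivatives. -/
def kMat (k : Fin K) (u v : ℝ) : Matrix (Fin 2) (Fin 2) ℝ := kerMat (s.ker k) (s.seg k) u v

/-- The vector `ₖM_u` of the mean function of a string and its derivative. -/
def mVec (k : Fin K) (u : ℝ) : Fin 2 → ℝ := meanVec (s.mean k) (s.seg k) u

/-- The matrix `ᵇₖM = ₖK_{right; left} ₖK_{left; left}⁻¹`. -/
def bM (k : Fin K) : Matrix (Fin 2) (Fin 2) ℝ :=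
  s.kMat k (s.right k) (s.left k) * (s.kMat k (s.left k) (s.left k))⁻¹

/-- The matrix `ᵇₖΣ = ₖK_{right; right} - ᵇₖM ₖK_{left; right}`. -/
def bSigma (k : Fin K) : Matrix (Fin 2) (Fin 2) ℝ :=
  s.kMat k (s.right k) (s.right k) - s.bM k * s.kMat k (s.left k) (s.right k)

/-- The covariance matrix `ₖK_{r;r} - ₖK_{r;l} ₖK_{l;l}⁻¹ ₖK_{r;l}ᵀ` of the boundary condition at
the right end `r` of a string given the one at its left end `l`. -/
def boundaryCov (k : Fin K) : Matrix (Fin 2) (Fin 2) ℝ :=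
  s.kMat k (s.right k) (s.right k) - s.kMat k (s.right k) (s.left k) *
    (s.kMat k (s.left k) (s.left k))⁻¹ * (s.kMat k (s.right k) (s.left k))ᵀ

/-- The mean `ₖM_r + ₖK_{r;l} ₖK_{l;l}⁻¹ (x - ₖM_l)` of the boundary condition at the right
end `r` of a string given the value `x` of the one at its left end `l`. -/
def boundaryMean (k : Fin K) (x : Fin 2 → ℝ) : Fin 2 → ℝ :=
  s.mVec k (s.right k) + (s.kMat k (s.right k) (s.left k) *
    (s.kMat k (s.left k) (s.left k))⁻¹) *ᵥ (x - s.mVec k (s.left k))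

/-- The probability density of the boundary conditions. -/
def boundaryDensity [NeZero K] (x : Fin (K + 1) → Fin 2 → ℝ) : ℝ :=
  gaussianDensity (x 0) (s.mVec 0 (s.time 0)) (s.kMat 0 (s.time 0) (s.time 0)) *
    ∏ k : Fin K, gaussianDensity (x k.succ) (s.boundaryMean k (x k.castSucc)) (s.boundaryCov k)

/-- Finite products of spaces of finite vectors are standard Borel. -/
instance standardBorelSpace_stringValues (K n : ℕ) :
    StandardBorelSpace (Fin K → Fin n → Fin 2 → ℝ) := by
  have h1 : StandardBorelSpace (Fin 2 → ℝ) := StandardBorelSpace.pi_countable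
  have h2 : StandardBorelSpace (Fin n → Fin 2 → ℝ) := StandardBorelSpace.pi_countable
  exact StandardBorelSpace.pi_countable

/-- `SD = (z, z')`, with `z` the coordinate `0` and `z'` the coordinate `1`, is a string
derivative Gaussian process with parameters `s` under the probability measure `P`. -/
structure IsStringDGP [NeZero K] {Ω : Type*} [MeasurableSpace Ω] (SD : ℝ → Ω → Fin 2 → ℝ)
    (P : Measure Ω) [IsProbabilityMeasure P] : Prop where
  measurable : ∀ t ∈ s.dom, Measurable (SD t)
  /-- The joint law of the boundary conditions has density `boundaryDensity`. -/
  boundary_law : P.map (fun ω (k : Fin (K + 1)) => SD (s.time k) ω) =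
    volume.withDensity (fun x => ENNReal.ofReal (s.boundaryDensity x))
  /-- Conditional on the boundary conditions, the restrictions to the open string intervals are
  independent conditional derivative Gaussian processes. The times `t k i` of the string `k` may
  be repeated, so it is no restriction that each string has the same number `n` of them. -/
  string_law : ∀ (n : ℕ) (t : Fin K → Fin n → ℝ),
    (∀ k i, t k i ∈ Ioo (s.left k) (s.right k)) →
    ∀ᵐ x ∂(P.map (fun ω (k : Fin (K + 1)) => SD (s.time k) ω)),
      ∃ ν : Fin K → Measure (Fin n → Fin 2 → ℝ),
        (∀ k, IsDGPLaw
          (condMean (s.mean k) (s.ker k) (s.left k) (s.right k) (x k.castSucc) (x k.succ))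
          (condKer (s.ker k) (s.left k) (s.right k)) (s.seg k) (t k) (ν k)) ∧
        condDistrib (fun ω k i => SD (t k i) ω)
          (fun ω (k : Fin (K + 1)) => SD (s.time k) ω) P x = Measure.pi ν

/-- The matrix `ₗΛ_x = [ₗK_{x;left} ₗK_{x;right}] ₗK_{(left,right);(left,right)}⁻¹`. -/
def lam (l : Fin K) (x : ℝ) : Matrix (Fin 2) (Fin 2 ⊕ Fin 2) ℝ :=
  Matrix.fromCols (s.kMat l x (s.left l)) (s.kMat l x (s.right l)) *
    (Matrix.fromBlocks
      (s.kMat l (s.left l) (s.left l)) (s.kMat l (s.left l) (s.right l))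
      (s.kMat l (s.right l) (s.left l)) (s.kMat l (s.right l) (s.right l)))⁻¹

/-- The explicit matrix of the conditional term, for `u` in the string `p` and `v` in the
string `q`. -/
def cKbar (p q : Fin K) (u v : ℝ) : Matrix (Fin 2) (Fin 2) ℝ :=
  if p = q then
    s.kMat p u v - s.lam p u *
      Matrix.fromRows (s.kMat p v (s.left p))ᵀ (s.kMat p v (s.right p))ᵀ
  else 0

end Params

/-- The string GP kernel: the covariance function of the first coordinate `z`. -/
def covKer {Ω : Type*} [MeasurableSpace Ω] (SD : ℝ → Ω → Fin 2 → ℝ) (P : Measure Ω)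
    (u v : ℝ) : ℝ :=
  cov[fun ω => SD u ω 0, fun ω => SD v ω 0; P]

/-- The matrix `K̄_{u;v}` of the covariances between `(z_u, z'_u)` and `(z_v, z'_v)`. -/
def Kbar {Ω : Type*} [MeasurableSpace Ω] (SD : ℝ → Ω → Fin 2 → ℝ) (P : Measure Ω)
    (u v : ℝ) : Matrix (Fin 2) (Fin 2) ℝ :=
  Matrix.of fun i j => cov[fun ω => SD u ω i, fun ω => SD v ω j; P]

/-- Conditional covariance of two random variables given a σ-algebra `F`. -/
def condCov {Ω : Type*} (F : MeasurableSpace Ω) {mΩ : MeasurableSpace Ω} (X Y : Ω → ℝ)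
    (P : Measure Ω) : Ω → ℝ :=
  P[fun ω => (X ω - (P[X | F]) ω) * (Y ω - (P[Y | F]) ω) | F]

/-- The σ-algebra generated by the boundary conditions at the end points of the strings
`p` and `q`. -/
@[reducible]
def boundarySigma {Ω : Type*} {K : ℕ} (s : Params K) (SD : ℝ → Ω → Fin 2 → ℝ) (p q : Fin K) :
    MeasurableSpace Ω :=
  MeasurableSpace.comap
    (fun ω => (SD (s.left p) ω, SD (s.right p) ω, SD (s.left q) ω, SD (s.right q) ω)) inferInstance

end StringGP

end

noncomputable section

namespace StringGP

/-! ### Differential calculus of kernels -/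

section Kernel

open Filter Topology

variable {κ : ℝ → ℝ → ℝ} {a b : ℝ}

/-! The process splits into a Gaussian Markov chain of boundary values and fluctuations inside the
strings that are uncorrelated with it. For `u` in the string `p`, the vector `(z_u, z'_u)` is a
constant, plus `lam p u` applied to the values at both ends of the string, plus a residual
(`eq_residual_add`). Given all boundary values, a residual has mean zero and the product of two
residuals has the deterministic conditional expectation `cKbar` (`condExp_residual`,
`condExp_residual_mul`). Residuals are therefore uncorrelated with every boundary value, and
bilinearity of the covariance gives the formula on the strings (`Kbar_string`). The conditional mean
involves only the ends of one string and the conditional second moments are constants, so the tower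
property carries them to the smaller σ-algebra `boundarySigma` (`condCov_string`).

For the boundary values, the product density says that each value is an affine function of the
preceding one plus independent centred Gaussian noise (`chainMeasure_succ`); the recursions follow
by induction (`hasChainMoments_chainMeasure`). The noise covariances must be positive definite.
Difference quotients turn the positivity of Gram matrices into positive semidefiniteness of the `4 ×
4` matrix of values and derivatives (`sum_kerMat_nonneg`), invertibility makes it definite, and its
Schur complement inherits this (`schurComplement_posDef`).

For the derivatives, the first row of `kMat k x v`, as a function of `x`, differentiates to the
second row. This property survives right multiplication by constant matrices and sums, so it passes
to `lam`, `cKbar` and, through the formula on each string, to `Kbar` (`hasDerivWithinAt_Kbar`). At a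
boundary time shared by two strings both formulas represent the same `Kbar`, so the one-sided
derivatives agree (`hasDerivWithinAt_dom`). -/

theorem uniqueDiffOn_square (hab : a < b) : UniqueDiffOn ℝ (Icc a b ×ˢ Icc a b) :=
  (uniqueDiffOn_Icc hab).prod (uniqueDiffOn_Icc hab)

theorem hasDerivWithinAt_left_of_contDiffOn {f : ℝ × ℝ → ℝ}
    (hf : ContDiffOn ℝ 1 f (Icc a b ×ˢ Icc a b)) {u v : ℝ} (hu : u ∈ Icc a b) (hv : v ∈ Icc a b) :
    HasDerivWithinAt (fun x => f (x, v))
      (fderivWithin ℝ f (Icc a b ×ˢ Icc a b) (u, v) (1, 0)) (Icc a b) u := by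
  have h1 : HasFDerivWithinAt f (fderivWithin ℝ f (Icc a b ×ˢ Icc a b) (u, v))
      (Icc a b ×ˢ Icc a b) (u, v) :=
    ((hf.differentiableOn one_ne_zero) (u, v) ⟨hu, hv⟩).hasFDerivWithinAt
  have h2 : HasDerivWithinAt (fun x : ℝ => (x, v)) ((1 : ℝ), (0 : ℝ)) (Icc a b) u :=
    (hasDerivWithinAt_id u _).prodMk (hasDerivWithinAt_const u _ v)
  exact h1.comp_hasDerivWithinAt u h2 (fun x hx => mk_mem_prod hx hv)

theorem hasDerivWithinAt_right_of_contDiffOn {f : ℝ × ℝ → ℝ}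
    (hf : ContDiffOn ℝ 1 f (Icc a b ×ˢ Icc a b)) {u v : ℝ} (hu : u ∈ Icc a b) (hv : v ∈ Icc a b) :
    HasDerivWithinAt (fun y => f (u, y))
      (fderivWithin ℝ f (Icc a b ×ˢ Icc a b) (u, v) (0, 1)) (Icc a b) v := by
  have h1 : HasFDerivWithinAt f (fderivWithin ℝ f (Icc a b ×ˢ Icc a b) (u, v))
      (Icc a b ×ˢ Icc a b) (u, v) :=
    ((hf.differentiableOn one_ne_zero) (u, v) ⟨hu, hv⟩).hasFDerivWithinAt
  have h2 : HasDerivWithinAt (fun y : ℝ => (u, y)) ((0 : ℝ), (1 : ℝ)) (Icc a b) v :=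
    (hasDerivWithinAt_const v _ u).prodMk (hasDerivWithinAt_id v _)
  exact h1.comp_hasDerivWithinAt v h2 (fun x hx => mk_mem_prod hu hx)

theorem partialX_eq_fderivWithin (hab : a < b)
    (hκ : ContDiffOn ℝ 2 (fun x : ℝ × ℝ => κ x.1 x.2) (Icc a b ×ˢ Icc a b))
    {u v : ℝ} (hu : u ∈ Icc a b) (hv : v ∈ Icc a b) :
    partialX κ (Icc a b) u v =
      fderivWithin ℝ (fun x : ℝ × ℝ => κ x.1 x.2) (Icc a b ×ˢ Icc a b) (u, v) (1, 0) :=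
  (hasDerivWithinAt_left_of_contDiffOn (hκ.of_le one_le_two) hu hv).derivWithin
    (uniqueDiffOn_Icc hab u hu)

theorem partialY_eq_fderivWithin (hab : a < b)
    (hκ : ContDiffOn ℝ 2 (fun x : ℝ × ℝ => κ x.1 x.2) (Icc a b ×ˢ Icc a b))
    {u v : ℝ} (hu : u ∈ Icc a b) (hv : v ∈ Icc a b) :
    partialY κ (Icc a b) u v =
      fderivWithin ℝ (fun x : ℝ × ℝ => κ x.1 x.2) (Icc a b ×ˢ Icc a b) (u, v) (0, 1) :=
  (hasDerivWithinAt_right_of_contDiffOn (hκ.of_le one_le_two) hu hv).derivWithin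
    (uniqueDiffOn_Icc hab v hv)

theorem contDiffOn_partialY (hab : a < b)
    (hκ : ContDiffOn ℝ 2 (fun x : ℝ × ℝ => κ x.1 x.2) (Icc a b ×ˢ Icc a b)) :
    ContDiffOn ℝ 1 (fun x : ℝ × ℝ => partialY κ (Icc a b) x.1 x.2) (Icc a b ×ˢ Icc a b) := by
  have h1 : ContDiffOn ℝ 1 (fderivWithin ℝ (fun x : ℝ × ℝ => κ x.1 x.2) (Icc a b ×ˢ Icc a b))
      (Icc a b ×ˢ Icc a b) :=
    hκ.fderivWithin (uniqueDiffOn_square hab) (by norm_num)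
  refine (h1.clm_apply (contDiffOn_const (c := ((0 : ℝ), (1 : ℝ))))).congr ?_
  rintro ⟨x, y⟩ ⟨hx, hy⟩
  exact partialY_eq_fderivWithin hab hκ hx hy

theorem hasDerivWithinAt_partialX
    (hκ : ContDiffOn ℝ 2 (fun x : ℝ × ℝ => κ x.1 x.2) (Icc a b ×ˢ Icc a b))
    {u v : ℝ} (hu : u ∈ Icc a b) (hv : v ∈ Icc a b) :
    HasDerivWithinAt (fun x => κ x v) (partialX κ (Icc a b) u v) (Icc a b) u :=
  (hasDerivWithinAt_left_of_contDiffOn (hκ.of_le one_le_two)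
    hu hv).differentiableWithinAt.hasDerivWithinAt

theorem hasDerivWithinAt_partialY
    (hκ : ContDiffOn ℝ 2 (fun x : ℝ × ℝ => κ x.1 x.2) (Icc a b ×ˢ Icc a b))
    {u v : ℝ} (hu : u ∈ Icc a b) (hv : v ∈ Icc a b) :
    HasDerivWithinAt (fun y => κ u y) (partialY κ (Icc a b) u v) (Icc a b) v :=
  (hasDerivWithinAt_right_of_contDiffOn (hκ.of_le one_le_two)
    hu hv).differentiableWithinAt.hasDerivWithinAt

theorem hasDerivWithinAt_partialXY (hab : a < b)
    (hκ : ContDiffOn ℝ 2 (fun x : ℝ × ℝ => κ x.1 x.2) (Icc a b ×ˢ Icc a b))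
    {u v : ℝ} (hu : u ∈ Icc a b) (hv : v ∈ Icc a b) :
    HasDerivWithinAt (fun x => partialY κ (Icc a b) x v) (partialXY κ (Icc a b) u v)
      (Icc a b) u :=
  (hasDerivWithinAt_left_of_contDiffOn (contDiffOn_partialY hab hκ)
    hu hv).differentiableWithinAt.hasDerivWithinAt

theorem continuousOn_partialXY (hab : a < b)
    (hκ : ContDiffOn ℝ 2 (fun x : ℝ × ℝ => κ x.1 x.2) (Icc a b ×ˢ Icc a b)) :
    ContinuousOn (fun x : ℝ × ℝ => partialXY κ (Icc a b) x.1 x.2) (Icc a b ×ˢ Icc a b) := by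
  have h1 := (contDiffOn_partialY hab hκ).continuousOn_fderivWithin (uniqueDiffOn_square hab)
    le_rfl
  refine (h1.clm_apply (continuousOn_const (c := ((1 : ℝ), (0 : ℝ))))).congr ?_
  rintro ⟨x, y⟩ ⟨hx, hy⟩
  exact (hasDerivWithinAt_left_of_contDiffOn (contDiffOn_partialY hab hκ) hx hy).derivWithin
    (uniqueDiffOn_Icc hab x hx)

/-- The first row of `kerMat` differentiates to the second one. -/
theorem hasDerivWithinAt_kerMat (hab : a < b)
    (hκ : ContDiffOn ℝ 2 (fun x : ℝ × ℝ => κ x.1 x.2) (Icc a b ×ˢ Icc a b))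
    {u v : ℝ} (hu : u ∈ Icc a b) (hv : v ∈ Icc a b) (j : Fin 2) :
    HasDerivWithinAt (fun x => kerMat κ (Icc a b) x v 0 j) (kerMat κ (Icc a b) u v 1 j)
      (Icc a b) u := by
  fin_cases j
  · simpa [kerMat] using hasDerivWithinAt_partialX hκ hu hv
  · simpa [kerMat] using hasDerivWithinAt_partialXY hab hκ hu hv

theorem partialY_comm (hsym : ∀ x ∈ Icc a b, ∀ y ∈ Icc a b, κ x y = κ y x)
    {u v : ℝ} (hu : u ∈ Icc a b) (hv : v ∈ Icc a b) :
    partialY κ (Icc a b) u v = partialX κ (Icc a b) v u :=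
  derivWithin_congr (fun y hy => hsym u hu y hy) (hsym u hu v hv)

theorem hasDerivWithinAt_fderivWithin_apply (hab : a < b) {f : ℝ × ℝ → ℝ}
    (hf : ContDiffOn ℝ 2 f (Icc a b ×ˢ Icc a b)) {p : ℝ × ℝ} (hp : p ∈ Icc a b ×ˢ Icc a b)
    (w : ℝ × ℝ) {γ : ℝ → ℝ × ℝ} {w' : ℝ × ℝ} {t : ℝ} (hγt : γ t = p)
    (hγ : HasDerivWithinAt γ w' (Icc a b) t) (hmaps : MapsTo γ (Icc a b) (Icc a b ×ˢ Icc a b)) :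
    HasDerivWithinAt (fun x => fderivWithin ℝ f (Icc a b ×ˢ Icc a b) (γ x) w)
      (fderivWithin ℝ (fderivWithin ℝ f (Icc a b ×ˢ Icc a b)) (Icc a b ×ˢ Icc a b) p w' w)
      (Icc a b) t := by
  subst hγt
  have h1 : ContDiffOn ℝ 1 (fderivWithin ℝ f (Icc a b ×ˢ Icc a b)) (Icc a b ×ˢ Icc a b) :=
    hf.fderivWithin (uniqueDiffOn_square hab) (by norm_num)
  have h2 := ((h1.differentiableOn one_ne_zero) _ hp).hasFDerivWithinAt
  have h3 := h2.comp_hasDerivWithinAt t hγ hmaps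
  have h4 := h3.clm_apply (hasDerivWithinAt_const t (Icc a b) w)
  simpa using h4

/-- Symmetry of `κ` turns one side into the derivative taken in the other order, so this is
Schwarz's theorem. It remains valid on the edges of the square because the square lies in the
closure of its interior. -/
theorem partialXY_comm (hab : a < b)
    (hκ : ContDiffOn ℝ 2 (fun x : ℝ × ℝ => κ x.1 x.2) (Icc a b ×ˢ Icc a b))
    (hsym : ∀ x ∈ Icc a b, ∀ y ∈ Icc a b, κ x y = κ y x)
    {u v : ℝ} (hu : u ∈ Icc a b) (hv : v ∈ Icc a b) :
    partialXY κ (Icc a b) v u = partialXY κ (Icc a b) u v := by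
  have e1 := hasDerivWithinAt_fderivWithin_apply hab hκ (p := (u, v)) ⟨hu, hv⟩ (1, 0)
    (γ := fun y => (u, y)) rfl
    ((hasDerivWithinAt_const v _ u).prodMk (hasDerivWithinAt_id v _)) (fun x hx => ⟨hu, hx⟩)
  have e2 := hasDerivWithinAt_fderivWithin_apply hab hκ (p := (u, v)) ⟨hu, hv⟩ (0, 1)
    (γ := fun x => (x, v)) rfl
    ((hasDerivWithinAt_id u _).prodMk (hasDerivWithinAt_const u _ v)) (fun x hx => ⟨hx, hv⟩)
  have e1' : partialXY κ (Icc a b) v u = _ :=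
    (e1.congr (fun x hx => (partialY_comm hsym hx hu).trans
      (partialX_eq_fderivWithin hab hκ hu hx))
      ((partialY_comm hsym hv hu).trans
      (partialX_eq_fderivWithin hab hκ hu hv))).derivWithin (uniqueDiffOn_Icc hab v hv)
  have e2' : partialXY κ (Icc a b) u v = _ :=
    (e2.congr (fun x hx => partialY_eq_fderivWithin hab hκ hx hv)
      (partialY_eq_fderivWithin hab hκ hu hv)).derivWithin (uniqueDiffOn_Icc hab u hu)
  rw [e1', e2']
  have hcl : (u, v) ∈ closure (interior (Icc a b ×ˢ Icc a b)) := by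
    rw [interior_prod_eq, interior_Icc, closure_prod_eq, closure_Ioo hab.ne]
    exact ⟨hu, hv⟩
  exact (hκ (u, v) ⟨hu, hv⟩).isSymmSndFDerivWithinAt (by simp) (uniqueDiffOn_square hab) hcl
    ⟨hu, hv⟩ (0, 1) (1, 0)

theorem kerMat_transpose (hab : a < b)
    (hκ : ContDiffOn ℝ 2 (fun x : ℝ × ℝ => κ x.1 x.2) (Icc a b ×ˢ Icc a b))
    (hsym : ∀ x ∈ Icc a b, ∀ y ∈ Icc a b, κ x y = κ y x)
    {u v : ℝ} (hu : u ∈ Icc a b) (hv : v ∈ Icc a b) :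
    (kerMat κ (Icc a b) u v)ᵀ = kerMat κ (Icc a b) v u := by
  ext i j
  fin_cases i <;> fin_cases j
  · simpa [kerMat] using hsym u hu v hv
  · simpa [kerMat] using (partialY_comm hsym hv hu).symm
  · simpa [kerMat] using partialY_comm hsym hu hv
  · simpa [kerMat] using (partialXY_comm hab hκ hsym hu hv).symm

/-! ### Positive semidefiniteness of the matrices of a kernel -/

theorem IsCovKernelOn.sum_nonneg {S : Set ℝ} (hκ : IsCovKernelOn κ S) {ι : Type*} [Fintype ι]
    (t : ι → ℝ) (ht : ∀ i, t i ∈ S) (c : ι → ℝ) :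
    0 ≤ ∑ i, ∑ j, c i * c j * κ (t i) (t j) := by
  have e := (Fintype.equivFin ι).symm
  have h := hκ.2 (Fintype.card ι) (t ∘ e) (fun i => ht _) (c ∘ e)
  have h2 : ∑ i, ∑ j, (c ∘ e) i * (c ∘ e) j * κ ((t ∘ e) i) ((t ∘ e) j) =
      ∑ i, ∑ j, c i * c j * κ (t i) (t j) := by
    rw [← e.sum_comp]
    exact Finset.sum_congr rfl fun i _ => e.sum_comp (fun j => c (e i) * c j * κ (t (e i)) (t j))
  rwa [h2] at h

/-- The double difference of a kernel is controlled by its mixed derivative. -/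
theorem abs_double_difference_le (hab : a < b)
    (hκ : ContDiffOn ℝ 2 (fun x : ℝ × ℝ => κ x.1 x.2) (Icc a b ×ˢ Icc a b))
    {u u' v v' D ε : ℝ} (hu : u ∈ Icc a b) (hu' : u' ∈ Icc a b) (hv : v ∈ Icc a b)
    (hv' : v' ∈ Icc a b)
    (hD : ∀ x ∈ uIcc u u', ∀ y ∈ uIcc v v', |partialXY κ (Icc a b) x y - D| ≤ ε) :
    |κ u' v' - κ u' v - κ u v' + κ u v - D * (u' - u) * (v' - v)| ≤
      ε * |u' - u| * |v' - v| := by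
  have hsu : uIcc u u' ⊆ Icc a b := uIcc_subset_Icc hu hu'
  have hsv : uIcc v v' ⊆ Icc a b := uIcc_subset_Icc hv hv'
  -- The mean value inequality is applied twice: in `x` to `∂κ/∂y` minus the linear function `D *
  -- x`, then in `y` to the resulting difference.
  have h1 : ∀ y ∈ uIcc v v', ‖partialY κ (Icc a b) u' y - partialY κ (Icc a b) u y - D * (u' - u)‖
      ≤ ε * |u' - u| := by
    intro y hy
    have hd : ∀ x ∈ uIcc u u', HasDerivWithinAt (fun x => partialY κ (Icc a b) x y - D * x)
        (partialXY κ (Icc a b) x y - D) (uIcc u u') x := fun x hx => by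
      simpa using ((hasDerivWithinAt_partialXY hab hκ (hsu hx) (hsv hy)).mono hsu).fun_sub
        ((hasDerivWithinAt_id x _).const_mul D)
    have h := Convex.norm_image_sub_le_of_norm_hasDerivWithin_le hd (C := ε)
      (fun x hx => hD x hx y hy) (convex_uIcc u u') left_mem_uIcc right_mem_uIcc
    have e : ∀ p q : ℝ, p - q - D * (u' - u) = p - D * u' - (q - D * u) := fun p q => by ring
    rwa [e]
  have hd : ∀ y ∈ uIcc v v', HasDerivWithinAt (fun y => κ u' y - κ u y - D * (u' - u) * y)
      (partialY κ (Icc a b) u' y - partialY κ (Icc a b) u y - D * (u' - u)) (uIcc v v') y :=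
    fun y hy => by
      simpa using (((hasDerivWithinAt_partialY hκ hu' (hsv hy)).mono hsv).fun_sub
        ((hasDerivWithinAt_partialY hκ hu (hsv hy)).mono hsv)).fun_sub
        ((hasDerivWithinAt_id y _).const_mul (D * (u' - u)))
  have h := Convex.norm_image_sub_le_of_norm_hasDerivWithin_le hd h1
    (convex_uIcc v v') left_mem_uIcc right_mem_uIcc
  rw [Real.norm_eq_abs, Real.norm_eq_abs] at h
  convert h using 2
  ring

/-- Continuity of the mixed derivative makes its oscillation small on the rectangle swept by the
increments, and the preceding bound applies with `D` its value at the corner. The signs of `σ` and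
`τ` let the increments point into the interval at either end. -/
theorem tendsto_double_difference (hab : a < b)
    (hκ : ContDiffOn ℝ 2 (fun x : ℝ × ℝ => κ x.1 x.2) (Icc a b ×ˢ Icc a b))
    {u v σ τ : ℝ} (hu : u ∈ Icc a b) (hv : v ∈ Icc a b) (hσ : σ ≠ 0) (hτ : τ ≠ 0)
    (hσu : ∀ᶠ h in 𝓝[>] (0 : ℝ), u + σ * h ∈ Icc a b)
    (hτv : ∀ᶠ h in 𝓝[>] (0 : ℝ), v + τ * h ∈ Icc a b) :
    Tendsto (fun h => (κ (u + σ * h) (v + τ * h) - κ (u + σ * h) v - κ u (v + τ * h) + κ u v) /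
      (σ * h * (τ * h))) (𝓝[>] 0) (𝓝 (partialXY κ (Icc a b) u v)) := by
  rw [Metric.tendsto_nhds]
  intro ε hε
  have hc := continuousOn_partialXY hab hκ (u, v) ⟨hu, hv⟩
  rw [Metric.continuousWithinAt_iff] at hc
  obtain ⟨δ, hδ, hc⟩ := hc (ε / 2) (half_pos hε)
  have hlim : ∀ ρ : ℝ, ∀ᶠ h in 𝓝[>] (0 : ℝ), |ρ * h| < δ := by
    intro ρ
    have : Tendsto (fun h : ℝ => |ρ * h|) (𝓝[>] 0) (𝓝 |ρ * 0|) :=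
      ((continuous_const.mul continuous_id).abs.tendsto 0).mono_left nhdsWithin_le_nhds
    exact this.eventually (gt_mem_nhds (by simpa using hδ))
  filter_upwards [hσu, hτv, hlim σ, hlim τ, self_mem_nhdsWithin] with h h1 h2 h3 h4 h5
  have h0 : h ≠ 0 := ne_of_gt h5
  have hD : ∀ x ∈ uIcc u (u + σ * h), ∀ y ∈ uIcc v (v + τ * h),
      |partialXY κ (Icc a b) x y - partialXY κ (Icc a b) u v| ≤ ε / 2 := by
    intro x hx y hy
    refine (hc (x := (x, y)) ⟨uIcc_subset_Icc hu h1 hx, uIcc_subset_Icc hv h2 hy⟩ ?_).le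
    rw [Prod.dist_eq, max_lt_iff]
    constructor
    · refine lt_of_le_of_lt ?_ h3
      simpa [Real.dist_eq, abs_sub_comm] using abs_sub_left_of_mem_uIcc hx
    · refine lt_of_le_of_lt ?_ h4
      simpa [Real.dist_eq, abs_sub_comm] using abs_sub_left_of_mem_uIcc hy
  have hmain := abs_double_difference_le hab hκ hu h1 hv h2 hD
  have hne : σ * h * (τ * h) ≠ 0 := mul_ne_zero (mul_ne_zero hσ h0) (mul_ne_zero hτ h0)
  rw [Real.dist_eq, div_sub' hne, abs_div, div_lt_iff₀ (abs_pos.2 hne)]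
  have e : κ (u + σ * h) (v + τ * h) - κ (u + σ * h) v - κ u (v + τ * h) + κ u v -
      σ * h * (τ * h) * partialXY κ (Icc a b) u v =
      κ (u + σ * h) (v + τ * h) - κ (u + σ * h) v - κ u (v + τ * h) + κ u v -
      partialXY κ (Icc a b) u v * (u + σ * h - u) * (v + τ * h - v) := by ring
  rw [e]
  refine hmain.trans_lt ?_
  rw [add_sub_cancel_left, add_sub_cancel_left, mul_assoc, ← abs_mul]
  exact mul_lt_mul_of_pos_right (half_lt_self hε) (abs_pos.2 hne)

theorem tendsto_difference_of_hasDerivWithinAt {f : ℝ → ℝ} {f' u σ : ℝ} (hσ : σ ≠ 0)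
    (hf : HasDerivWithinAt f f' (Icc a b) u)
    (hσu : ∀ᶠ h in 𝓝[>] (0 : ℝ), u + σ * h ∈ Icc a b) :
    Tendsto (fun h => (f (u + σ * h) - f u) / (σ * h)) (𝓝[>] 0) (𝓝 f') := by
  rw [hasDerivWithinAt_iff_tendsto_slope] at hf
  have h1 : Tendsto (fun h => u + σ * h) (𝓝[>] 0) (𝓝[Icc a b \ {u}] u) := by
    refine tendsto_nhdsWithin_iff.2 ⟨?_, ?_⟩
    · have : Tendsto (fun h : ℝ => u + σ * h) (𝓝 0) (𝓝 (u + σ * 0)) :=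
        (continuous_const.add (continuous_const.mul continuous_id)).tendsto 0
      simpa using this.mono_left nhdsWithin_le_nhds
    · filter_upwards [hσu, self_mem_nhdsWithin] with h h1 h2
      refine ⟨h1, ?_⟩
      simpa [hσ] using ne_of_gt h2
  refine (hf.comp h1).congr fun h => ?_
  simp [slope_def_field]

/-- The covariance matrix of the values and the derivatives at finitely many times is positive
semidefinite. The number `σ i` is the direction in which the time `τ i` can be moved. -/
theorem sum_kerMat_nonneg (hab : a < b)
    (hκ : ContDiffOn ℝ 2 (fun x : ℝ × ℝ => κ x.1 x.2) (Icc a b ×ˢ Icc a b))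
    (hcov : IsCovKernelOn κ (Icc a b)) {ι : Type*} [Fintype ι] (τ σ : ι → ℝ)
    (hτ : ∀ i, τ i ∈ Icc a b) (hσ : ∀ i, σ i ≠ 0)
    (hστ : ∀ i, ∀ᶠ h in 𝓝[>] (0 : ℝ), τ i + σ i * h ∈ Icc a b) (c d : ι → ℝ) :
    0 ≤ ∑ i, ∑ j, (c i * c j * κ (τ i) (τ j) + c i * d j * partialY κ (Icc a b) (τ i) (τ j) +
      d i * c j * partialX κ (Icc a b) (τ i) (τ j) +
      d i * d j * partialXY κ (Icc a b) (τ i) (τ j)) := by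
  have hlim : Tendsto (fun h => ∑ i, ∑ j, (c i * c j * κ (τ i) (τ j) +
      c i * d j * ((κ (τ i) (τ j + σ j * h) - κ (τ i) (τ j)) / (σ j * h)) +
      d i * c j * ((κ (τ i + σ i * h) (τ j) - κ (τ i) (τ j)) / (σ i * h)) +
      d i * d j * ((κ (τ i + σ i * h) (τ j + σ j * h) - κ (τ i + σ i * h) (τ j) -
        κ (τ i) (τ j + σ j * h) + κ (τ i) (τ j)) / (σ i * h * (σ j * h))))) (𝓝[>] 0)
      (𝓝 (∑ i, ∑ j, (c i * c j * κ (τ i) (τ j) + c i * d j * partialY κ (Icc a b) (τ i) (τ j) +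
      d i * c j * partialX κ (Icc a b) (τ i) (τ j) +
      d i * d j * partialXY κ (Icc a b) (τ i) (τ j)))) := by
    refine tendsto_finsetSum _ fun i _ => tendsto_finsetSum _ fun j _ => ?_
    refine ((tendsto_const_nhds.add (Tendsto.const_mul _ ?_)).add (Tendsto.const_mul _ ?_)).add
      (Tendsto.const_mul _ ?_)
    · exact tendsto_difference_of_hasDerivWithinAt (hσ j)
        (hasDerivWithinAt_partialY hκ (hτ i) (hτ j)) (hστ j)
    · exact tendsto_difference_of_hasDerivWithinAt (f := fun x => κ x (τ j)) (hσ i)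
        (hasDerivWithinAt_partialX hκ (hτ i) (hτ j)) (hστ i)
    · exact tendsto_double_difference hab hκ (hτ i) (hτ j) (hσ i) (hσ j) (hστ i) (hστ j)
  refine ge_of_tendsto hlim ?_
  filter_upwards [Filter.eventually_all.2 hστ, self_mem_nhdsWithin] with h h1 h2
  have h0 : h ≠ 0 := ne_of_gt h2
  -- These weights at `τ i` and `τ i + σ i * h` represent `c i * z` plus `d i` times the difference
  -- quotient of `z`; the sum is the variance of the total over `i`.
  have key := hcov.sum_nonneg (ι := ι ⊕ ι) (Sum.elim τ fun i => τ i + σ i * h)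
    (by rintro (i | i); exacts [hτ i, h1 i])
    (Sum.elim (fun i => c i - d i / (σ i * h)) fun i => d i / (σ i * h))
  simp only [Fintype.sum_sum_type, Sum.elim_inl, Sum.elim_inr, ← Finset.sum_add_distrib] at key
  refine key.trans_eq ?_
  refine Finset.sum_congr rfl fun i _ => Finset.sum_congr rfl fun j _ => ?_
  have hi := hσ i
  have hj := hσ j
  field_simp
  ring

theorem eventually_left_add_mem (hab : a < b) :
    ∀ᶠ h in 𝓝[>] (0 : ℝ), a + 1 * h ∈ Icc a b := by
  filter_upwards [Ioc_mem_nhdsGT (sub_pos.2 hab)] with h hh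
  constructor <;> linarith [hh.1, hh.2]

theorem eventually_right_sub_mem (hab : a < b) :
    ∀ᶠ h in 𝓝[>] (0 : ℝ), b + (-1) * h ∈ Icc a b := by
  filter_upwards [Ioc_mem_nhdsGT (sub_pos.2 hab)] with h hh
  constructor <;> linarith [hh.1, hh.2]

theorem kerMatPair_posSemidef (hab : a < b)
    (hκ : ContDiffOn ℝ 2 (fun x : ℝ × ℝ => κ x.1 x.2) (Icc a b ×ˢ Icc a b))
    (hcov : IsCovKernelOn κ (Icc a b)) : (kerMatPair κ (Icc a b) a b).PosSemidef := by
  have ha : a ∈ Icc a b := left_mem_Icc.2 hab.le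
  have hb : b ∈ Icc a b := right_mem_Icc.2 hab.le
  refine PosSemidef.of_dotProduct_mulVec_nonneg ?_ fun x => ?_
  · rw [Matrix.IsHermitian, conjTranspose_eq_transpose_of_trivial, kerMatPair,
      fromBlocks_transpose, kerMat_transpose hab hκ hcov.1 ha ha,
      kerMat_transpose hab hκ hcov.1 hb ha, kerMat_transpose hab hκ hcov.1 ha hb,
      kerMat_transpose hab hκ hcov.1 hb hb]
  -- The directions `1` at `a` and `-1` at `b` point into the interval.
  · have h := sum_kerMat_nonneg hab hκ hcov ![a, b] ![1, -1] (by simp [hab.le]) (by simp)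
      (by simpa using ⟨by simpa using eventually_left_add_mem hab,
        by simpa using eventually_right_sub_mem hab⟩)
      ![x (.inl 0), x (.inr 0)] ![x (.inl 1), x (.inr 1)]
    refine h.trans_eq ?_
    simp [kerMatPair, kerMat, dotProduct, mulVec, Fin.sum_univ_two]
    ring

theorem kerMatPair_posDef (hab : a < b)
    (hκ : ContDiffOn ℝ 2 (fun x : ℝ × ℝ => κ x.1 x.2) (Icc a b ×ˢ Icc a b))
    (hcov : IsCovKernelOn κ (Icc a b)) (hdet : (kerMatPair κ (Icc a b) a b).det ≠ 0) :
    (kerMatPair κ (Icc a b) a b).PosDef :=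
  (kerMatPair_posSemidef hab hκ hcov).posDef_iff_det_ne_zero.2 hdet

theorem kerMat_left_posDef (h : (kerMatPair κ (Icc a b) a b).PosDef) :
    (kerMat κ (Icc a b) a a).PosDef := by
  have h' := h.submatrix (e := (Sum.inl : Fin 2 → Fin 2 ⊕ Fin 2)) Sum.inl_injective
  exact h'

/-- The Schur complement of a positive semidefinite block matrix with positive definite corner is
positive semidefinite. The block determinant is the product of the determinants of the corner and of
the complement, so the latter is nonzero. -/
theorem schurComplement_posDef (hab : a < b)
    (hκ : ContDiffOn ℝ 2 (fun x : ℝ × ℝ => κ x.1 x.2) (Icc a b ×ˢ Icc a b))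
    (hcov : IsCovKernelOn κ (Icc a b)) (hdet : (kerMatPair κ (Icc a b) a b).det ≠ 0) :
    (kerMat κ (Icc a b) b b - kerMat κ (Icc a b) b a * (kerMat κ (Icc a b) a a)⁻¹ *
      (kerMat κ (Icc a b) b a)ᵀ).PosDef := by
  have ha : a ∈ Icc a b := left_mem_Icc.2 hab.le
  have hb : b ∈ Icc a b := right_mem_Icc.2 hab.le
  have hA := kerMat_left_posDef (kerMatPair_posDef hab hκ hcov hdet)
  have hdetA : (kerMat κ (Icc a b) a a).det ≠ 0 := hA.det_pos.ne'
  have : Invertible (kerMat κ (Icc a b) a a) := invertibleOfIsUnitDet _ hdetA.isUnit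
  rw [kerMat_transpose hab hκ hcov.1 hb ha]
  have h1 := kerMatPair_posSemidef hab hκ hcov
  rw [kerMatPair, ← kerMat_transpose hab hκ hcov.1 ha hb,
    ← conjTranspose_eq_transpose_of_trivial, PosDef.fromBlocks₁₁ _ _ hA,
    conjTranspose_eq_transpose_of_trivial, kerMat_transpose hab hκ hcov.1 ha hb] at h1
  rw [h1.posDef_iff_det_ne_zero]
  rw [kerMatPair, det_fromBlocks₁₁, invOf_eq_nonsing_inv] at hdet
  exact right_ne_zero_of_mul hdet

end Kernel
end StringGP
end

noncomputable section

namespace StringGP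

/-! ### Gaussian densities -/

section Gaussian

open scoped ENNReal

variable {d : ℕ}

theorem map_withDensity_comp {α β : Type*} [MeasurableSpace α] [MeasurableSpace β] (μ : Measure α)
    {T : α → β} (hT : Measurable T) {h : β → ℝ≥0∞} (hh : Measurable h) :
    (μ.withDensity (h ∘ T)).map T = (μ.map T).withDensity h := by
  ext s hs
  rw [Measure.map_apply hT hs, withDensity_apply _ (hT hs), withDensity_apply _ hs,
    setLIntegral_map hs hh hT]
  rfl

/-- The standard Gaussian measure on `Fin d → ℝ`. -/
def stdGaussianPi (d : ℕ) : Measure (Fin d → ℝ) := Measure.pi fun _ => gaussianReal 0 1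

instance (d : ℕ) : IsProbabilityMeasure (stdGaussianPi d) := by
  unfold stdGaussianPi; infer_instance

/-- A product measure is determined by its values on boxes, where the integral of a product of
functions of separate coordinates factorises. -/
theorem pi_withDensity {ι : Type*} [Fintype ι] {f : ι → ℝ → ℝ} (hf0 : ∀ i x, 0 ≤ f i x)
    (hint : ∀ i, Integrable (f i)) :
    Measure.pi (fun i => (volume : Measure ℝ).withDensity fun x => ENNReal.ofReal (f i x)) =
      (volume : Measure (ι → ℝ)).withDensity fun x => ENNReal.ofReal (∏ i, f i (x i)) := by
  have hfin : ∀ i, IsFiniteMeasure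
      ((volume : Measure ℝ).withDensity fun x => ENNReal.ofReal (f i x)) := fun i =>
    isFiniteMeasure_withDensity_ofReal (hint i).2
  refine Measure.pi_eq fun s hs => ?_
  have hprod : Integrable (fun x : ι → ℝ => ∏ i, f i (x i))
      (Measure.pi fun i => volume.restrict (s i)) :=
    Integrable.fintype_prod (fun i => (hint i).restrict)
  rw [withDensity_apply _ (MeasurableSet.univ_pi hs), volume_pi, Measure.restrict_pi_pi,
    ← ofReal_integral_eq_lintegral_ofReal hprod
      (Filter.Eventually.of_forall fun x => Finset.prod_nonneg fun i _ => hf0 i _),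
    integral_fintype_prod_eq_prod, ENNReal.ofReal_prod_of_nonneg
      fun i _ => integral_nonneg (hf0 i)]
  refine Finset.prod_congr rfl fun i _ => ?_
  rw [withDensity_apply _ (hs i), ← ofReal_integral_eq_lintegral_ofReal (hint i).restrict
    (Filter.Eventually.of_forall fun x => hf0 i x)]

theorem stdGaussianPi_eq_withDensity (d : ℕ) : stdGaussianPi d =
    volume.withDensity fun x =>
      ENNReal.ofReal (gaussianDensity x 0 (1 : Matrix (Fin d) (Fin d) ℝ)) := by
  have h : gaussianReal 0 1 =
      (volume : Measure ℝ).withDensity fun x => ENNReal.ofReal (gaussianPDFReal 0 1 x) := by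
    rw [gaussianReal_of_var_ne_zero _ one_ne_zero]; rfl
  rw [stdGaussianPi, h, pi_withDensity (fun _ => gaussianPDFReal_nonneg 0 1)
    (fun _ => integrable_gaussianPDFReal 0 1)]
  congr 1
  ext x
  congr 1
  simp only [gaussianPDFReal, gaussianDensity, Finset.prod_mul_distrib, ← Real.exp_sum,
    Finset.prod_const, Finset.card_univ, Fintype.card_fin, inv_one, det_one, one_mulVec, sub_zero,
    mul_one, NNReal.coe_one, inv_pow]
  congr 2
  · rw [Real.sqrt_eq_rpow, Real.sqrt_eq_rpow, ← Real.rpow_natCast, ← Real.rpow_natCast,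
      ← Real.rpow_mul (by positivity), ← Real.rpow_mul (by positivity),
      mul_comm (1 / 2 : ℝ)]
  · simp only [dotProduct, Finset.mul_sum]
    refine Finset.sum_congr rfl fun i _ => ?_
    ring

theorem measurable_gaussianDensity {α : Type*} [MeasurableSpace α] {f g : α → Fin d → ℝ}
    (hf : Measurable f) (hg : Measurable g) (C : Matrix (Fin d) (Fin d) ℝ) :
    Measurable fun x => gaussianDensity (f x) (g x) C := by
  have : Measurable fun x => f x - g x := hf.sub hg
  unfold gaussianDensity dotProduct mulVec dotProduct
  fun_prop

theorem measurable_ofReal_gaussianDensity (μ : Fin d → ℝ) (C : Matrix (Fin d) (Fin d) ℝ) :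
    Measurable fun x => ENNReal.ofReal (gaussianDensity x μ C) :=
  (measurable_gaussianDensity measurable_id measurable_const C).ennreal_ofReal

theorem gaussianDensity_nonneg (x μ : Fin d → ℝ) (C : Matrix (Fin d) (Fin d) ℝ) :
    0 ≤ gaussianDensity x μ C := by
  unfold gaussianDensity; positivity

/-- The centred Gaussian measure with covariance matrix `C`, as a measure with a density. -/
def gaussianMeasure (C : Matrix (Fin d) (Fin d) ℝ) : Measure (Fin d → ℝ) :=
  volume.withDensity fun x => ENNReal.ofReal (gaussianDensity x 0 C)

/-- Under `x = Bᵀ w` the quadratic form of `(Bᵀ * B)⁻¹` becomes `w ⬝ᵥ w`, and the square root of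
`det (Bᵀ * B)` is `|det B|`. -/
theorem gaussianDensity_transpose_mul {B : Matrix (Fin d) (Fin d) ℝ} (hB : B.det ≠ 0)
    (w : Fin d → ℝ) : gaussianDensity (Bᵀ *ᵥ w) 0 (Bᵀ * B) =
      |(Bᵀ.det)⁻¹| * gaussianDensity w 0 1 := by
  have h1 : Bᵀ.det ≠ 0 := by rwa [det_transpose]
  have e : (Bᵀ *ᵥ w) ⬝ᵥ ((Bᵀ * B)⁻¹ *ᵥ (Bᵀ *ᵥ w)) = w ⬝ᵥ w := by
    rw [mulVec_mulVec, Matrix.mul_inv_rev, Matrix.mul_assoc, nonsing_inv_mul _ h1.isUnit,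
      Matrix.mul_one, mulVec_transpose, ← dotProduct_mulVec, mulVec_mulVec,
      mul_nonsing_inv _ hB.isUnit, one_mulVec]
  simp only [gaussianDensity, sub_zero, inv_one, one_mulVec, e, det_one, mul_one]
  rw [det_mul, det_transpose, Real.sqrt_mul (by positivity), Real.sqrt_mul_self_eq_abs, mul_inv,
    abs_inv]
  ring

/-- The factor `|det Bᵀ|` between the two densities cancels the Jacobian of the linear change of
variables. Moments of `gaussianMeasure` thus reduce to those of independent standard normals. -/
theorem gaussianMeasure_eq_map {C B : Matrix (Fin d) (Fin d) ℝ} (hC : C = Bᵀ * B)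
    (hB : B.det ≠ 0) :
    gaussianMeasure C = (stdGaussianPi d).map fun w => Bᵀ *ᵥ w := by
  have hT : Measurable fun w : Fin d → ℝ => Bᵀ *ᵥ w := by
    unfold mulVec dotProduct; fun_prop
  have h1 : Bᵀ.det ≠ 0 := by rwa [det_transpose]
  have h2 : Measurable fun x : Fin d → ℝ =>
      ENNReal.ofReal |Bᵀ.det| * ENNReal.ofReal (gaussianDensity x 0 C) :=
    (measurable_ofReal_gaussianDensity 0 C).const_mul _
  have h3 : (fun w => ENNReal.ofReal (gaussianDensity w 0 (1 : Matrix (Fin d) (Fin d) ℝ))) =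
      (fun x => ENNReal.ofReal |Bᵀ.det| * ENNReal.ofReal (gaussianDensity x 0 C)) ∘
        fun w => Bᵀ *ᵥ w := by
    ext w
    simp only [Function.comp]
    rw [hC, gaussianDensity_transpose_mul hB, ← ENNReal.ofReal_mul (abs_nonneg _), ← mul_assoc,
      ← abs_mul, mul_inv_cancel₀ h1, abs_one, one_mul]
  have h4 : (volume : Measure (Fin d → ℝ)).map (fun w => Bᵀ *ᵥ w) =
      ENNReal.ofReal (|(Bᵀ.det)⁻¹|) • volume :=
    Real.map_matrix_volume_pi_eq_smul_volume_pi h1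
  rw [stdGaussianPi_eq_withDensity, h3, map_withDensity_comp _ hT h2, h4, gaussianMeasure,
    withDensity_smul_measure]
  have h5 : (fun x => ENNReal.ofReal |Bᵀ.det| * ENNReal.ofReal (gaussianDensity x 0 C)) =
    ENNReal.ofReal |Bᵀ.det| • fun x : Fin d → ℝ => ENNReal.ofReal (gaussianDensity x 0 C) := rfl
  rw [h5, withDensity_smul _ (measurable_ofReal_gaussianDensity 0 C), smul_smul,
    ← ENNReal.ofReal_mul (abs_nonneg _), ← abs_mul, inv_mul_cancel₀ h1]
  simp

theorem memLp_stdGaussianPi (i : Fin d) : MemLp (fun w : Fin d → ℝ => w i) 2 (stdGaussianPi d) :=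
  (memLp_id_gaussianReal (μ := 0) (v := 1) 2).comp_measurePreserving
    (measurePreserving_eval (fun _ => gaussianReal 0 1) i)

theorem covariance_stdGaussianPi (i j : Fin d) :
    cov[fun w => w i, fun w => w j; stdGaussianPi d] = (1 : Matrix (Fin d) (Fin d) ℝ) i j := by
  by_cases h : i = j
  · subst h
    have hm := measurePreserving_eval (fun _ : Fin d => gaussianReal 0 1) i
    have := variance_map (X := fun x : ℝ => x) (μ := stdGaussianPi d) (Y := Function.eval i)
      aemeasurable_id (measurable_pi_apply i).aemeasurable
    rw [stdGaussianPi, hm.map_eq, variance_fun_id_gaussianReal] at this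
    rw [covariance_self (measurable_pi_apply i).aemeasurable, one_apply_eq]
    simpa [stdGaussianPi, Function.comp_def] using this.symm
  · rw [one_apply_ne h]
    have hi : iIndepFun (fun (i : Fin d) (w : Fin d → ℝ) => w i) (stdGaussianPi d) :=
      iIndepFun_pi (X := fun _ x => x) (fun _ => aemeasurable_id)
    exact (hi.indepFun h).covariance_eq_zero (memLp_stdGaussianPi i) (memLp_stdGaussianPi j)

theorem memLp_mulVec {Ω : Type*} [MeasurableSpace Ω] {P : Measure Ω} {m n : Type*} [Fintype n]
    (A : Matrix m n ℝ) {X : Ω → n → ℝ} (hX : ∀ i, MemLp (fun ω => X ω i) 2 P) (i : m) :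
    MemLp (fun ω => (A *ᵥ X ω) i) 2 P := by
  simp only [mulVec, dotProduct]
  exact memLp_finsetSum _ fun j _ => (hX j).const_mul _

theorem covariance_mulVec_left {Ω : Type*} [MeasurableSpace Ω] {P : Measure Ω} [IsFiniteMeasure P]
    {m n : Type*} [Fintype n] (A : Matrix m n ℝ) {X : Ω → n → ℝ} {Y : Ω → ℝ}
    (hX : ∀ i, MemLp (fun ω => X ω i) 2 P) (hY : MemLp Y 2 P) (i : m) :
    cov[fun ω => (A *ᵥ X ω) i, Y; P] = ∑ j, A i j * cov[fun ω => X ω j, Y; P] := by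
  simp only [mulVec, dotProduct]
  rw [covariance_fun_sum_left (fun j => (hX j).const_mul _) hY]
  simp only [covariance_const_mul_left]

variable {C : Matrix (Fin d) (Fin d) ℝ}

/-- The factor `B` exists because a nonnegative element of a C⋆-algebra has the form `star B * B`;
definiteness of `C` makes it invertible. -/
theorem exists_gaussianMeasure_eq_map (hC : C.PosDef) :
    ∃ B : Matrix (Fin d) (Fin d) ℝ, C = Bᵀ * B ∧
      gaussianMeasure C = (stdGaussianPi d).map fun w => Bᵀ *ᵥ w := by
  obtain ⟨B, hB⟩ : ∃ B : Matrix (Fin d) (Fin d) ℝ, C = Bᵀ * B := by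
    open scoped MatrixOrder in
    obtain ⟨B, hB⟩ := CStarAlgebra.nonneg_iff_eq_star_mul_self.mp hC.posSemidef.nonneg
    exact ⟨B, by rw [hB, star_eq_conjTranspose, conjTranspose_eq_transpose_of_trivial]⟩
  refine ⟨B, hB, gaussianMeasure_eq_map hB fun h => ?_⟩
  have := hC.det_pos
  rw [hB, det_mul, h, mul_zero] at this
  exact this.false

theorem measurable_mulVec {m n : Type*} [Fintype n] (A : Matrix m n ℝ) :
    Measurable fun w : n → ℝ => A *ᵥ w := by
  unfold mulVec dotProduct; fun_prop

theorem isProbabilityMeasure_gaussianMeasure (hC : C.PosDef) :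
    IsProbabilityMeasure (gaussianMeasure C) := by
  obtain ⟨B, -, hB⟩ := exists_gaussianMeasure_eq_map hC
  rw [hB]
  exact Measure.isProbabilityMeasure_map (measurable_mulVec _).aemeasurable

theorem memLp_gaussianMeasure (hC : C.PosDef) (i : Fin d) :
    MemLp (fun w : Fin d → ℝ => w i) 2 (gaussianMeasure C) := by
  obtain ⟨B, -, hB⟩ := exists_gaussianMeasure_eq_map hC
  rw [hB, memLp_map_measure_iff (measurable_pi_apply i).aestronglyMeasurable
    (measurable_mulVec _).aemeasurable]
  exact memLp_mulVec _ memLp_stdGaussianPi i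

theorem covariance_gaussianMeasure (hC : C.PosDef) (i j : Fin d) :
    cov[fun w => w i, fun w => w j; gaussianMeasure C] = C i j := by
  obtain ⟨B, hCB, hB⟩ := exists_gaussianMeasure_eq_map hC
  rw [hB, covariance_map_fun (measurable_pi_apply i).aestronglyMeasurable
    (measurable_pi_apply j).aestronglyMeasurable (measurable_mulVec _).aemeasurable,
    covariance_mulVec_left _ memLp_stdGaussianPi (memLp_mulVec _ memLp_stdGaussianPi j)]
  simp_rw [covariance_comm (fun w : Fin d → ℝ => w _),
    covariance_mulVec_left _ memLp_stdGaussianPi (memLp_stdGaussianPi _),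
    covariance_stdGaussianPi]
  simp [hCB, mul_apply, one_apply]

theorem withDensity_gaussianDensity_eq_map (μ : Fin d → ℝ) (C : Matrix (Fin d) (Fin d) ℝ) :
    volume.withDensity (fun x => ENNReal.ofReal (gaussianDensity x μ C)) =
      (gaussianMeasure C).map fun w => μ + w := by
  have h : (fun x => ENNReal.ofReal (gaussianDensity x 0 C)) =
      (fun x => ENNReal.ofReal (gaussianDensity x μ C)) ∘ fun w => μ + w := by
    ext w
    simp [gaussianDensity]
  rw [gaussianMeasure, h, map_withDensity_comp _ (by fun_prop)
    (measurable_ofReal_gaussianDensity μ C),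
    map_add_left_eq_self]

end Gaussian

end StringGP
end

noncomputable section

namespace StringGP

/-! ### Gaussian Markov chains -/

section Chain

open scoped ENNReal

variable {d : ℕ}

/-- The density of a Gaussian Markov chain with initial law `N(b₀, C₀)` and transition laws
`N(β k x, C k)`. -/
def chainDensity {n : ℕ} (b₀ : Fin d → ℝ) (C₀ : Matrix (Fin d) (Fin d) ℝ)
    (β : Fin n → (Fin d → ℝ) → Fin d → ℝ) (C : Fin n → Matrix (Fin d) (Fin d) ℝ)
    (x : Fin (n + 1) → Fin d → ℝ) : ℝ :=
  gaussianDensity (x 0) b₀ C₀ *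
    ∏ k : Fin n, gaussianDensity (x k.succ) (β k (x k.castSucc)) (C k)

/-- The law of a Gaussian Markov chain. -/
def chainMeasure {n : ℕ} (b₀ : Fin d → ℝ) (C₀ : Matrix (Fin d) (Fin d) ℝ)
    (β : Fin n → (Fin d → ℝ) → Fin d → ℝ) (C : Fin n → Matrix (Fin d) (Fin d) ℝ) :
    Measure (Fin (n + 1) → Fin d → ℝ) :=
  volume.withDensity fun x => ENNReal.ofReal (chainDensity b₀ C₀ β C x)

theorem measurable_chainDensity {n : ℕ} (b₀ : Fin d → ℝ) (C₀ : Matrix (Fin d) (Fin d) ℝ)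
    {β : Fin n → (Fin d → ℝ) → Fin d → ℝ} (hβ : ∀ k, Measurable (β k))
    (C : Fin n → Matrix (Fin d) (Fin d) ℝ) : Measurable (chainDensity b₀ C₀ β C) := by
  refine (measurable_gaussianDensity (measurable_pi_apply 0) measurable_const _).mul
    (Finset.measurable_fun_prod _ fun k _ => ?_)
  exact measurable_gaussianDensity (measurable_pi_apply _)
    ((hβ k).comp (measurable_pi_apply _)) _

theorem chainDensity_snoc {n : ℕ} (b₀ : Fin d → ℝ) (C₀ : Matrix (Fin d) (Fin d) ℝ)
    (β : Fin (n + 1) → (Fin d → ℝ) → Fin d → ℝ) (C : Fin (n + 1) → Matrix (Fin d) (Fin d) ℝ)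
    (x : Fin (n + 1) → Fin d → ℝ) (y : Fin d → ℝ) :
    chainDensity b₀ C₀ β C (Fin.snoc (α := fun _ => Fin d → ℝ) x y) =
      chainDensity b₀ C₀ (fun k => β k.castSucc) (fun k => C k.castSucc) x *
        gaussianDensity y (β (Fin.last n) (x (Fin.last n))) (C (Fin.last n)) := by
  have h0 : Fin.snoc (α := fun _ => Fin d → ℝ) x y 0 = x 0 :=
    Fin.snoc_castSucc (α := fun _ => Fin d → ℝ) y x 0
  rw [chainDensity, chainDensity, Fin.prod_univ_castSucc, h0, mul_assoc]
  simp only [Fin.succ_castSucc, Fin.succ_last, Fin.snoc_castSucc, Fin.snoc_last]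

theorem lintegral_fin_snoc {n : ℕ} {f : (Fin (n + 1) → Fin d → ℝ) → ℝ≥0∞} (hf : Measurable f) :
    ∫⁻ x, f x = ∫⁻ x : Fin n → Fin d → ℝ, ∫⁻ y : Fin d → ℝ,
      f (Fin.snoc (α := fun _ => Fin d → ℝ) x y) := by
  have h := (volume_preserving_piFinSuccAbove (fun _ : Fin (n + 1) => Fin d → ℝ) (Fin.last n)).symm
  rw [← h.lintegral_comp hf, Measure.volume_eq_prod, lintegral_prod_symm']
  · simp [MeasurableEquiv.piFinSuccAbove, Fin.insertNthEquiv, Fin.insertNth_last']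
  · exact hf.comp (MeasurableEquiv.measurable _)

theorem measurable_fin_snoc {n : ℕ} : Measurable
    fun p : (Fin n → Fin d → ℝ) × (Fin d → ℝ) => Fin.snoc (α := fun _ => Fin d → ℝ) p.1 p.2 := by
  refine measurable_pi_lambda _ fun i => ?_
  refine Fin.lastCases ?_ (fun i => ?_) i
  · simpa using measurable_snd
  · simpa [Function.comp_def] using (measurable_pi_apply i).comp measurable_fst

/-- The innovation form of the last transition. With the earlier states held fixed, the last
Gaussian factor is the law of its mean plus centred noise, and the noise has the same law whatever
those states are, which yields a product measure. -/
theorem chainMeasure_succ {n : ℕ} (b₀ : Fin d → ℝ) (C₀ : Matrix (Fin d) (Fin d) ℝ)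
    {β : Fin (n + 1) → (Fin d → ℝ) → Fin d → ℝ} (hβ : ∀ k, Measurable (β k))
    (C : Fin (n + 1) → Matrix (Fin d) (Fin d) ℝ) (hC : (C (Fin.last n)).PosDef) :
    chainMeasure b₀ C₀ β C =
      ((chainMeasure b₀ C₀ (fun k => β k.castSucc) (fun k => C k.castSucc)).prod
        (gaussianMeasure (C (Fin.last n)))).map fun p =>
          Fin.snoc (α := fun _ => Fin d → ℝ) p.1
            (β (Fin.last n) (p.1 (Fin.last n)) + p.2) := by
  have := isProbabilityMeasure_gaussianMeasure hC
  have hΦ : Measurable fun p : (Fin (n + 1) → Fin d → ℝ) × (Fin d → ℝ) =>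
      Fin.snoc (α := fun _ => Fin d → ℝ) p.1 (β (Fin.last n) (p.1 (Fin.last n)) + p.2) :=
    measurable_fin_snoc.comp (measurable_fst.prodMk
      ((((hβ _).comp (measurable_pi_apply _)).comp measurable_fst).add measurable_snd))
  refine Measure.ext_of_lintegral _ fun f hf => ?_
  have hd := (measurable_chainDensity b₀ C₀ hβ C).ennreal_ofReal
  have hd' := (measurable_chainDensity b₀ C₀ (fun k : Fin n => hβ k.castSucc)
    (fun k => C k.castSucc)).ennreal_ofReal
  have hinner : Measurable fun x : Fin (n + 1) → Fin d → ℝ =>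
      ∫⁻ w, f (Fin.snoc (α := fun _ => Fin d → ℝ) x (β (Fin.last n) (x (Fin.last n)) + w))
        ∂gaussianMeasure (C (Fin.last n)) := (hf.comp hΦ).lintegral_prod_right'
  have hcomp : Measurable fun p : (Fin (n + 1) → Fin d → ℝ) × (Fin d → ℝ) =>
      f (Fin.snoc (α := fun _ => Fin d → ℝ) p.1 (β (Fin.last n) (p.1 (Fin.last n)) + p.2)) :=
    hf.comp hΦ
  rw [lintegral_map hf hΦ, lintegral_prod _ hcomp.aemeasurable, chainMeasure, chainMeasure,
    lintegral_withDensity_eq_lintegral_mul _ hd hf,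
    lintegral_withDensity_eq_lintegral_mul _ hd' hinner, lintegral_fin_snoc (hd.mul hf)]
  refine lintegral_congr fun x => ?_
  simp only [Pi.mul_apply]
  have hfx : Measurable fun y => f (Fin.snoc (α := fun _ => Fin d → ℝ) x y) :=
    hf.comp (measurable_fin_snoc.comp (measurable_const.prodMk measurable_id))
  rw [← lintegral_map (f := fun y => f (Fin.snoc (α := fun _ => Fin d → ℝ) x y)) hfx
    (measurable_const_add _), ← withDensity_gaussianDensity_eq_map,
    lintegral_withDensity_eq_lintegral_mul _ (measurable_ofReal_gaussianDensity _ _) hfx,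
    ← lintegral_const_mul _ ((measurable_ofReal_gaussianDensity _ _).mul hfx)]
  refine lintegral_congr fun y => ?_
  rw [chainDensity_snoc, ENNReal.ofReal_mul, Pi.mul_apply, mul_assoc]
  unfold chainDensity
  exact mul_nonneg (gaussianDensity_nonneg _ _ _)
    (Finset.prod_nonneg fun k _ => gaussianDensity_nonneg _ _ _)

theorem chainMeasure_zero (b₀ : Fin d → ℝ) (C₀ : Matrix (Fin d) (Fin d) ℝ)
    (β : Fin 0 → (Fin d → ℝ) → Fin d → ℝ) (C : Fin 0 → Matrix (Fin d) (Fin d) ℝ) :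
    chainMeasure b₀ C₀ β C = (gaussianMeasure C₀).map fun w (_ : Fin (0 + 1)) => b₀ + w := by
  have h := (volume_preserving_funUnique (Fin 1) (Fin d → ℝ)).symm
  have h1 : (fun x => ENNReal.ofReal (gaussianDensity x b₀ C₀)) =
      (fun x => ENNReal.ofReal (chainDensity b₀ C₀ β C x)) ∘
        (MeasurableEquiv.funUnique (Fin 1) (Fin d → ℝ)).symm := by
    ext x
    simp [chainDensity, MeasurableEquiv.funUnique]
  have h2 : Measurable fun x => ENNReal.ofReal (chainDensity b₀ C₀ β C x) :=
    (measurable_chainDensity b₀ C₀ (fun k => k.elim0) C).ennreal_ofReal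
  have h3 : (fun (w : Fin d → ℝ) (_ : Fin 1) => b₀ + w) =
      (MeasurableEquiv.funUnique (Fin 1) (Fin d → ℝ)).symm ∘ fun w => b₀ + w := by
    ext w i
    simp [MeasurableEquiv.funUnique]
  rw [h3, ← Measure.map_map (MeasurableEquiv.measurable _) (by fun_prop),
    ← withDensity_gaussianDensity_eq_map, h1,
    map_withDensity_comp _ (MeasurableEquiv.measurable _) h2, h.map_eq, chainMeasure]
  rfl

/-- The second order properties of a Gaussian Markov chain whose transitions have linear parts
`A k`. -/
structure HasChainMoments {n : ℕ} (C₀ : Matrix (Fin d) (Fin d) ℝ)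
    (A C : Fin n → Matrix (Fin d) (Fin d) ℝ) (M : Measure (Fin (n + 1) → Fin d → ℝ)) : Prop where
  isProbabilityMeasure : IsProbabilityMeasure M
  memLp : ∀ k c, MemLp (fun x : Fin (n + 1) → Fin d → ℝ => x k c) 2 M
  cov_zero : ∀ i j, cov[fun x => x 0 i, fun x => x 0 j; M] = C₀ i j
  cov_succ_of_lt : ∀ (k : Fin n) (l : Fin (n + 1)), l < k.succ → ∀ i j,
    cov[fun x => x k.succ i, fun x => x l j; M] =
      ∑ e, A k i e * cov[fun x => x k.castSucc e, fun x => x l j; M]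
  cov_succ_succ : ∀ (k : Fin n) i j,
    cov[fun x => x k.succ i, fun x => x k.succ j; M] =
      C k i j + ∑ e, A k i e * cov[fun x => x k.castSucc e, fun x => x k.succ j; M]

/-- By induction on the length: the new state is affine in the last one plus noise independent of
the past, so each covariance expands by bilinearity and only the noise against itself contributes `C
k`. -/
theorem hasChainMoments_chainMeasure {n : ℕ} (b₀ : Fin d → ℝ) {C₀ : Matrix (Fin d) (Fin d) ℝ}
    (hC₀ : C₀.PosDef) (b : Fin n → Fin d → ℝ) (A C : Fin n → Matrix (Fin d) (Fin d) ℝ)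
    (hC : ∀ k, (C k).PosDef) :
    HasChainMoments C₀ A C (chainMeasure b₀ C₀ (fun k x => b k + A k *ᵥ x) C) := by
  induction n with
  | zero =>
    have := isProbabilityMeasure_gaussianMeasure hC₀
    have hm : Measurable fun (w : Fin d → ℝ) (_ : Fin (0 + 1)) => b₀ + w := by fun_prop
    rw [chainMeasure_zero]
    have hL : ∀ c, MemLp (fun w : Fin d → ℝ => b₀ c + w c) 2 (gaussianMeasure C₀) := fun c =>
      (memLp_const (b₀ c)).add (memLp_gaussianMeasure hC₀ c)
    have hmeas : ∀ (k : Fin (0 + 1)) (c : Fin d),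
        Measurable fun x : Fin (0 + 1) → Fin d → ℝ => x k c := fun k c => by fun_prop
    refine ⟨Measure.isProbabilityMeasure_map hm.aemeasurable, fun k c => ?_, fun i j => ?_,
      fun k => k.elim0, fun k => k.elim0⟩
    · exact (memLp_map_measure_iff (hmeas k c).aestronglyMeasurable hm.aemeasurable).2 (hL c)
    · refine (covariance_map_fun (hmeas 0 i).aestronglyMeasurable
        (hmeas 0 j).aestronglyMeasurable hm.aemeasurable).trans ?_
      simp only [Pi.add_apply]
      rw [covariance_const_add_left ((memLp_gaussianMeasure hC₀ i).integrable one_le_two),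
        covariance_const_add_right ((memLp_gaussianMeasure hC₀ j).integrable one_le_two),
        covariance_gaussianMeasure hC₀]
  | succ n ih =>
    specialize ih (fun k => b k.castSucc) (fun k => A k.castSucc) (fun k => C k.castSucc)
      (fun k => hC _)
    have hβ : ∀ k, Measurable fun x : Fin d → ℝ => b k + A k *ᵥ x := fun k =>
      measurable_const.add (measurable_mulVec _)
    rw [chainMeasure_succ b₀ C₀ hβ C (hC _)]
    set M := chainMeasure b₀ C₀ (fun (k : Fin n) x => b k.castSucc + A k.castSucc *ᵥ x)
      (fun k => C k.castSucc) with hM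
    have hMp := ih.isProbabilityMeasure
    have hN := isProbabilityMeasure_gaussianMeasure (hC (Fin.last n))
    set N := gaussianMeasure (C (Fin.last n))
    have hΦ : Measurable fun p : (Fin (n + 1) → Fin d → ℝ) × (Fin d → ℝ) =>
        Fin.snoc (α := fun _ => Fin d → ℝ) p.1
          (b (Fin.last n) + A (Fin.last n) *ᵥ (p.1 (Fin.last n)) + p.2) :=
      measurable_fin_snoc.comp (measurable_fst.prodMk
        ((((hβ _).comp (measurable_pi_apply _)).comp measurable_fst).add measurable_snd))
    have hmeas : ∀ (k : Fin (n + 2)) (c : Fin d),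
        Measurable fun x : Fin (n + 2) → Fin d → ℝ => x k c := fun k c => by fun_prop
    have hcov : ∀ (k l : Fin (n + 2)) (i j : Fin d),
        cov[fun x => x k i, fun x => x l j; (M.prod N).map fun p =>
          Fin.snoc (α := fun _ => Fin d → ℝ) p.1
            (b (Fin.last n) + A (Fin.last n) *ᵥ (p.1 (Fin.last n)) + p.2)] =
        cov[fun p => Fin.snoc (α := fun _ => Fin d → ℝ) p.1
            (b (Fin.last n) + A (Fin.last n) *ᵥ (p.1 (Fin.last n)) + p.2) k i,
          fun p => Fin.snoc (α := fun _ => Fin d → ℝ) p.1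
            (b (Fin.last n) + A (Fin.last n) *ᵥ (p.1 (Fin.last n)) + p.2) l j; M.prod N] :=
      fun k l i j => covariance_map_fun (hmeas k i).aestronglyMeasurable
        (hmeas l j).aestronglyMeasurable hΦ.aemeasurable
    have hfstL : ∀ k c, MemLp (fun p : (Fin (n + 1) → Fin d → ℝ) × (Fin d → ℝ) => p.1 k c) 2
        (M.prod N) := fun k c => (ih.memLp k c).comp_measurePreserving measurePreserving_fst
    have hsndL : ∀ c, MemLp (fun p : (Fin (n + 1) → Fin d → ℝ) × (Fin d → ℝ) => p.2 c) 2
        (M.prod N) := fun c =>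
      (memLp_gaussianMeasure (hC (Fin.last n)) c).comp_measurePreserving measurePreserving_snd
    have hAL : ∀ c, MemLp (fun p : (Fin (n + 1) → Fin d → ℝ) × (Fin d → ℝ) =>
        (A (Fin.last n) *ᵥ (p.1 (Fin.last n))) c) 2 (M.prod N) := fun c =>
      memLp_mulVec _ (hfstL (Fin.last n)) c
    have hlastL : ∀ c, MemLp (fun p : (Fin (n + 1) → Fin d → ℝ) × (Fin d → ℝ) =>
        b (Fin.last n) c + (A (Fin.last n) *ᵥ (p.1 (Fin.last n))) c + p.2 c) 2 (M.prod N) :=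
      fun c => ((memLp_const (b (Fin.last n) c)).add (hAL c)).add (hsndL c)
    have hff : ∀ (k l : Fin (n + 1)) (i j : Fin d),
        cov[fun p => p.1 k i, fun p => p.1 l j; M.prod N] =
          cov[fun x => x k i, fun x => x l j; M] := fun k l i j => by
      have h := covariance_map_fun (μ := M.prod N) (Z := Prod.fst)
        (X := fun x : Fin (n + 1) → Fin d → ℝ => x k i)
        (Y := fun x : Fin (n + 1) → Fin d → ℝ => x l j)
        (Measurable.aestronglyMeasurable (by fun_prop))
        (Measurable.aestronglyMeasurable (by fun_prop)) measurable_fst.aemeasurable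
      rw [measurePreserving_fst.map_eq] at h
      exact h.symm
    have hss : ∀ (i j : Fin d), cov[fun p => p.2 i, fun p => p.2 j; M.prod N] =
        C (Fin.last n) i j := fun i j => by
      have h := covariance_map_fun (μ := M.prod N) (Z := Prod.snd)
        (X := fun x : Fin d → ℝ => x i) (Y := fun x : Fin d → ℝ => x j)
        (Measurable.aestronglyMeasurable (by fun_prop))
        (Measurable.aestronglyMeasurable (by fun_prop)) measurable_snd.aemeasurable
      rw [measurePreserving_snd.map_eq, covariance_gaussianMeasure (hC _)] at h
      exact h.symm
    have hsf : ∀ (k : Fin (n + 1)) (i j : Fin d),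
        cov[fun p => p.2 i, fun p => p.1 k j; M.prod N] = 0 := fun k i j => by
      rw [covariance_comm]
      exact covariance_fst_snd_prod (ih.memLp k j) (memLp_gaussianMeasure (hC (Fin.last n)) i)
    -- covariance of the last variable with a square integrable one
    have hlast : ∀ (i : Fin d) {Y : (Fin (n + 1) → Fin d → ℝ) × (Fin d → ℝ) → ℝ},
        MemLp Y 2 (M.prod N) →
        cov[fun p => b (Fin.last n) i + (A (Fin.last n) *ᵥ (p.1 (Fin.last n))) i + p.2 i, Y;
          M.prod N] = ∑ e, A (Fin.last n) i e * cov[fun p => p.1 (Fin.last n) e, Y; M.prod N] +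
            cov[fun p => p.2 i, Y; M.prod N] := by
      intro i Y hY
      have h1 := covariance_add_left ((memLp_const (b (Fin.last n) i)).add (hAL i)) (hsndL i) hY
      refine h1.trans ?_
      congr 1
      have h2 := covariance_const_add_left (Y := Y)
        ((hAL i).integrable one_le_two) (b (Fin.last n) i)
      exact h2.trans (covariance_mulVec_left _ (hfstL (Fin.last n)) hY i)
    refine ⟨Measure.isProbabilityMeasure_map hΦ.aemeasurable, fun k c => ?_, fun i j => ?_,
      fun k l hl i j => ?_, fun k i j => ?_⟩
    · rw [memLp_map_measure_iff (hmeas k c).aestronglyMeasurable hΦ.aemeasurable]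
      refine Fin.lastCases ?_ (fun k => ?_) k
      · simpa [Function.comp_def] using hlastL c
      · simpa [Function.comp_def] using hfstL k c
    · rw [hcov]
      have h0 : (0 : Fin (n + 2)) = Fin.castSucc 0 := rfl
      simp only [h0, Fin.snoc_castSucc]
      rw [hff, ih.cov_zero]
    · simp only [hcov]
      -- Since `l < k.succ`, the index `l` is not the last one and refers to the shorter chain.
      obtain ⟨l, rfl⟩ : ∃ l' : Fin (n + 1), l = l'.castSucc :=
        ⟨l.castPred (ne_of_lt (hl.trans_le (Fin.le_last _))), by simp⟩
      induction k using Fin.lastCases with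
      | last =>
        simp only [Fin.succ_last, Fin.snoc_last, Fin.snoc_castSucc, Pi.add_apply]
        rw [hlast i (hfstL l j), hsf, add_zero]
      | cast k =>
        rw [Fin.succ_castSucc] at hl ⊢
        simp only [Fin.snoc_castSucc, hff]
        exact ih.cov_succ_of_lt k l (Fin.castSucc_lt_castSucc_iff.1 hl) i j
    · simp only [hcov]
      induction k using Fin.lastCases with
      | last =>
        simp only [Fin.succ_last, Fin.snoc_last, Fin.snoc_castSucc, Pi.add_apply]
        rw [hlast i (hlastL j), add_comm]
        congr 1
        -- The noise meets the last state only through itself. Expanding in the exchanged order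
        -- produces `C j i`, so the symmetry of the covariance matrix is needed at the end.
        rw [covariance_comm, hlast j (hsndL i), hss]
        simp only [covariance_comm (fun p : (Fin (n + 1) → Fin d → ℝ) × (Fin d → ℝ) => p.1 _ _),
          hsf, mul_zero, Finset.sum_const_zero, zero_add]
        have hsym := (hC (Fin.last n)).1
        exact hsym.apply i j
      | cast k =>
        rw [Fin.succ_castSucc]
        simp only [Fin.snoc_castSucc, hff]
        exact ih.cov_succ_succ k i j

end Chain

end StringGP
end

noncomputable section

namespace StringGP

namespace Params

/-! ### Algebra and calculus of the parameters of a string Gaussian process -/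

variable {K : ℕ} (s : Params K)

theorem left_lt_right (k : Fin K) : s.left k < s.right k :=
  s.time_strictMono k.castSucc_lt_succ

theorem left_mem_seg (k : Fin K) : s.left k ∈ s.seg k := left_mem_Icc.2 (s.left_lt_right k).le

theorem right_mem_seg (k : Fin K) : s.right k ∈ s.seg k := right_mem_Icc.2 (s.left_lt_right k).le

theorem uniqueDiffOn_seg (k : Fin K) : UniqueDiffOn ℝ (s.seg k) :=
  uniqueDiffOn_Icc (s.left_lt_right k)

theorem ker_contDiffOn_two (k : Fin K) : ContDiffOn ℝ 2 (fun x : ℝ × ℝ => s.ker k x.1 x.2)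
    (Icc (s.left k) (s.right k) ×ˢ Icc (s.left k) (s.right k)) :=
  (s.ker_contDiffOn k).of_le (by norm_num)

/-- The Gram matrix of the boundary conditions of a string. -/
def gram (k : Fin K) : Matrix (Fin 2 ⊕ Fin 2) (Fin 2 ⊕ Fin 2) ℝ :=
  kerMatPair (s.ker k) (s.seg k) (s.left k) (s.right k)

/-- Degeneracy given the left end already includes non-degeneracy at the left end, so both
assumptions are needed to exclude a vanishing determinant. -/
theorem gram_det_ne_zero (k : Fin K) : (s.gram k).det ≠ 0 := fun h =>
  s.ker_not_degenerateAtGiven k ⟨s.ker_not_degenerateAt k, h⟩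

theorem gram_posDef (k : Fin K) : (s.gram k).PosDef :=
  kerMatPair_posDef (s.left_lt_right k) (s.ker_contDiffOn_two k) (s.ker_isCovKernelOn k)
    (s.gram_det_ne_zero k)

theorem gram_transpose (k : Fin K) : (s.gram k)ᵀ = s.gram k := by
  have := (s.gram_posDef k).1
  rwa [Matrix.IsHermitian, conjTranspose_eq_transpose_of_trivial] at this

theorem kMat_transpose (k : Fin K) {u v : ℝ} (hu : u ∈ s.seg k) (hv : v ∈ s.seg k) :
    (s.kMat k u v)ᵀ = s.kMat k v u :=
  kerMat_transpose (s.left_lt_right k) (s.ker_contDiffOn_two k) (s.ker_isCovKernelOn k).1 hu hv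

theorem kMat_left_left_posDef (k : Fin K) : (s.kMat k (s.left k) (s.left k)).PosDef :=
  kerMat_left_posDef (s.gram_posDef k)

theorem boundaryCov_posDef (k : Fin K) : (s.boundaryCov k).PosDef :=
  schurComplement_posDef (s.left_lt_right k) (s.ker_contDiffOn_two k) (s.ker_isCovKernelOn k)
    (s.gram_det_ne_zero k)

theorem boundaryCov_eq_bSigma (k : Fin K) : s.boundaryCov k = s.bSigma k := by
  rw [boundaryCov, bSigma, bM, s.kMat_transpose k (s.right_mem_seg k) (s.left_mem_seg k)]

theorem bM_mul_kMat (k : Fin K) :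
    s.bM k * s.kMat k (s.left k) (s.left k) = s.kMat k (s.right k) (s.left k) := by
  rw [bM, Matrix.mul_assoc, nonsing_inv_mul _ (s.kMat_left_left_posDef k).det_pos.ne'.isUnit,
    Matrix.mul_one]

/-- The matrix `[ₖK_{x;left} ₖK_{x;right}]`. -/
def rowMat (k : Fin K) (x : ℝ) : Matrix (Fin 2) (Fin 2 ⊕ Fin 2) ℝ :=
  Matrix.fromCols (s.kMat k x (s.left k)) (s.kMat k x (s.right k))

theorem lam_eq (k : Fin K) (x : ℝ) : s.lam k x = s.rowMat k x * (s.gram k)⁻¹ := rfl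

theorem cKbar_self (p : Fin K) (u v : ℝ) :
    s.cKbar p p u v = s.kMat p u v - s.lam p u * (s.rowMat p v)ᵀ := by
  rw [cKbar, if_pos rfl, rowMat, transpose_fromCols]

theorem cKbar_of_ne {p q : Fin K} (h : p ≠ q) (u v : ℝ) : s.cKbar p q u v = 0 := if_neg h

theorem cKbar_transpose (p q : Fin K) {u v : ℝ} (hu : u ∈ s.seg p) (hv : v ∈ s.seg q) :
    (s.cKbar p q u v)ᵀ = s.cKbar q p v u := by
  by_cases h : p = q
  · subst h
    rw [cKbar_self, cKbar_self, transpose_sub, s.kMat_transpose p hu hv, lam_eq, lam_eq,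
      transpose_mul, transpose_mul, transpose_transpose, transpose_nonsing_inv, s.gram_transpose,
      Matrix.mul_assoc]
  · rw [s.cKbar_of_ne h, s.cKbar_of_ne (Ne.symm h), transpose_zero]

theorem rowMat_eq_mul_gram_left (k : Fin K) :
    s.rowMat k (s.left k) =
      (Matrix.fromCols 1 0 : Matrix (Fin 2) (Fin 2 ⊕ Fin 2) ℝ) * s.gram k := by
  rw [gram, kerMatPair, ← fromRows_fromCols_eq_fromBlocks, fromCols_mul_fromRows, Matrix.one_mul,
    Matrix.zero_mul, add_zero]
  rfl

theorem rowMat_eq_mul_gram_right (k : Fin K) :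
    s.rowMat k (s.right k) =
      (Matrix.fromCols 0 1 : Matrix (Fin 2) (Fin 2 ⊕ Fin 2) ℝ) * s.gram k := by
  rw [gram, kerMatPair, ← fromRows_fromCols_eq_fromBlocks, fromCols_mul_fromRows, Matrix.one_mul,
    Matrix.zero_mul, zero_add]
  rfl

/-- At an end point, `rowMat` is a block row of the Gram matrix, so multiplying by the inverse
leaves a coordinate projection: the interpolation reproduces the value at that end. -/
theorem lam_left (k : Fin K) : s.lam k (s.left k) = Matrix.fromCols 1 0 := by
  rw [lam_eq, rowMat_eq_mul_gram_left, Matrix.mul_assoc,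
    mul_nonsing_inv _ (s.gram_det_ne_zero k).isUnit, Matrix.mul_one]

theorem lam_right (k : Fin K) : s.lam k (s.right k) = Matrix.fromCols 0 1 := by
  rw [lam_eq, rowMat_eq_mul_gram_right, Matrix.mul_assoc,
    mul_nonsing_inv _ (s.gram_det_ne_zero k).isUnit, Matrix.mul_one]

/-- Nothing remains random at an end point once its value is given. This allows closed strings
although the conditional law is prescribed only on open ones. -/
theorem cKbar_left (p q : Fin K) {v : ℝ} (hv : v ∈ s.seg q) : s.cKbar p q (s.left p) v = 0 := by
  by_cases h : p = q
  · subst h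
    rw [cKbar_self, lam_left, rowMat, transpose_fromCols, fromCols_mul_fromRows, Matrix.one_mul,
      Matrix.zero_mul, add_zero, s.kMat_transpose p hv (s.left_mem_seg p), sub_self]
  · exact s.cKbar_of_ne h _ _

theorem cKbar_right (p q : Fin K) {v : ℝ} (hv : v ∈ s.seg q) : s.cKbar p q (s.right p) v = 0 := by
  by_cases h : p = q
  · subst h
    rw [cKbar_self, lam_right, rowMat, transpose_fromCols, fromCols_mul_fromRows, Matrix.one_mul,
      Matrix.zero_mul, zero_add, s.kMat_transpose p hv (s.right_mem_seg p), sub_self]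
  · exact s.cKbar_of_ne h _ _

theorem hasDerivWithinAt_kMat (k : Fin K) {u v : ℝ} (hu : u ∈ s.seg k) (hv : v ∈ s.seg k)
    (j : Fin 2) : HasDerivWithinAt (fun x => s.kMat k x v 0 j) (s.kMat k u v 1 j) (s.seg k) u :=
  hasDerivWithinAt_kerMat (s.left_lt_right k) (s.ker_contDiffOn_two k) hu hv j

theorem hasDerivWithinAt_rowMat (k : Fin K) {u : ℝ} (hu : u ∈ s.seg k) (j : Fin 2 ⊕ Fin 2) :
    HasDerivWithinAt (fun x => s.rowMat k x 0 j) (s.rowMat k u 1 j) (s.seg k) u := by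
  rcases j with j | j
  · exact s.hasDerivWithinAt_kMat k hu (s.left_mem_seg k) j
  · exact s.hasDerivWithinAt_kMat k hu (s.right_mem_seg k) j

/-- If the first row of a matrix differentiates to the second one, so does that of its products
with a constant matrix. -/
theorem hasDerivWithinAt_mul_const {m n : Type*} [Fintype m] {F : ℝ → Matrix (Fin 2) m ℝ}
    {S : Set ℝ} {u : ℝ} (hF : ∀ j, HasDerivWithinAt (fun x => F x 0 j) (F u 1 j) S u)
    (B : Matrix m n ℝ) (j : n) :
    HasDerivWithinAt (fun x => (F x * B) 0 j) ((F u * B) 1 j) S u := by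
  simp only [mul_apply]
  exact HasDerivWithinAt.fun_sum fun i _ => (hF i).mul_const (B i j)

theorem hasDerivWithinAt_lam (k : Fin K) {u : ℝ} (hu : u ∈ s.seg k) (j : Fin 2 ⊕ Fin 2) :
    HasDerivWithinAt (fun x => s.lam k x 0 j) (s.lam k u 1 j) (s.seg k) u :=
  hasDerivWithinAt_mul_const (s.hasDerivWithinAt_rowMat k hu) (s.gram k)⁻¹ j

theorem hasDerivWithinAt_cKbar (p q : Fin K) {u v : ℝ} (hu : u ∈ s.seg p) (hv : v ∈ s.seg q)
    (j : Fin 2) :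
    HasDerivWithinAt (fun x => s.cKbar p q x v 0 j) (s.cKbar p q u v 1 j) (s.seg p) u := by
  by_cases h : p = q
  · subst h
    simp only [cKbar_self]
    exact (s.hasDerivWithinAt_kMat p hu hv j).sub
      (hasDerivWithinAt_mul_const (s.hasDerivWithinAt_lam p hu) _ j)
  · simp only [s.cKbar_of_ne h]
    exact hasDerivWithinAt_const _ _ _

theorem kerRow_eq (p : Fin K) (t : ℝ) :
    kerRow (s.ker p) (Icc (s.left p) (s.right p)) (s.left p) (s.right p) t = s.rowMat p t 0 := by
  ext j
  rcases j with j | j <;> fin_cases j <;> rfl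

theorem kerRow_dotProduct (p : Fin K) (t : ℝ) (w : Fin 2 ⊕ Fin 2 → ℝ) :
    kerRow (s.ker p) (Icc (s.left p) (s.right p)) (s.left p) (s.right p) t ⬝ᵥ
      ((kerMatPair (s.ker p) (Icc (s.left p) (s.right p)) (s.left p) (s.right p))⁻¹ *ᵥ w) =
    (s.lam p t *ᵥ w) 0 := by
  rw [lam_eq, ← mulVec_mulVec, kerRow_eq]
  rfl

/-- The conditional mean of `(z_u, z'_u)` given the values `x, y` at the ends of the string. -/
def condMeanVec (p : Fin K) (x y : Fin 2 → ℝ) (u : ℝ) : Fin 2 → ℝ :=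
  s.mVec p u + s.lam p u *ᵥ Sum.elim (x - s.mVec p (s.left p)) (y - s.mVec p (s.right p))

/-- The law in `IsStringDGP` involves the derivative of the scalar function `condMean`; since the
first row of `lam` differentiates to the second, it is the second coordinate of the vector formula.
-/
theorem meanVec_condMean (p : Fin K) (x y : Fin 2 → ℝ) {u : ℝ} (hu : u ∈ s.seg p) :
    meanVec (condMean (s.mean p) (s.ker p) (s.left p) (s.right p) x y) (s.seg p) u =
      s.condMeanVec p x y u := by
  have h : condMean (s.mean p) (s.ker p) (s.left p) (s.right p) x y = fun t =>
      s.mean p t + (s.lam p t *ᵥ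
        Sum.elim (x - s.mVec p (s.left p)) (y - s.mVec p (s.right p))) 0 := by
    ext t
    rw [condMean, kerRow_dotProduct]
    rfl
  have hm : HasDerivWithinAt (s.mean p) (derivWithin (s.mean p) (s.seg p) u) (s.seg p) u :=
    ((s.mean_contDiffOn p).differentiableOn one_ne_zero u hu).hasDerivWithinAt
  have hl : HasDerivWithinAt (fun t => (s.lam p t *ᵥ
      Sum.elim (x - s.mVec p (s.left p)) (y - s.mVec p (s.right p))) 0)
      ((s.lam p u *ᵥ
        Sum.elim (x - s.mVec p (s.left p)) (y - s.mVec p (s.right p))) 1) (s.seg p) u := by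
    simp only [mulVec, dotProduct]
    exact HasDerivWithinAt.fun_sum fun i _ => (s.hasDerivWithinAt_lam p hu i).mul_const _
  have hd := (hm.add hl).derivWithin (s.uniqueDiffOn_seg p u hu)
  ext c
  fin_cases c
  · simp [meanVec, h, condMeanVec, mVec]
  · simp only [meanVec, h, condMeanVec, mVec]
    exact hd

theorem condKer_eq (p : Fin K) (u v : ℝ) :
    condKer (s.ker p) (s.left p) (s.right p) u v = s.cKbar p p u v 0 0 := by
  rw [condKer, kerRow_dotProduct, cKbar_self, kerRow_eq, Matrix.sub_apply]
  rfl

theorem kerMat_condKer (p : Fin K) {u v : ℝ} (hu : u ∈ s.seg p) (hv : v ∈ s.seg p) :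
    kerMat (condKer (s.ker p) (s.left p) (s.right p)) (s.seg p) u v = s.cKbar p p u v := by
  have hT : ∀ x ∈ s.seg p, ∀ y ∈ s.seg p, ∀ i j,
      s.cKbar p p x y i j = s.cKbar p p y x j i := fun x hx y hy i j => by
    rw [← s.cKbar_transpose p p hx hy, transpose_apply]
  have hY : ∀ x ∈ s.seg p, ∀ y ∈ s.seg p,
      partialY (condKer (s.ker p) (s.left p) (s.right p)) (s.seg p) x y =
        s.cKbar p p x y 0 1 := fun x hx y hy => by
    -- The derivative in the second variable is read off from the one in the first through the
    -- transposition symmetry `hT`.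
    have h := ((s.hasDerivWithinAt_cKbar p p hy hx 0).congr
      (fun t ht => (s.condKer_eq p x t).trans (hT x hx t ht 0 0))
      ((s.condKer_eq p x y).trans (hT x hx y hy 0 0))).derivWithin (s.uniqueDiffOn_seg p y hy)
    rw [hT x hx y hy]
    exact h
  have hX : partialX (condKer (s.ker p) (s.left p) (s.right p)) (s.seg p) u v =
      s.cKbar p p u v 1 0 :=
    ((s.hasDerivWithinAt_cKbar p p hu hv 0).congr (fun t _ => s.condKer_eq p t v)
      (s.condKer_eq p u v)).derivWithin (s.uniqueDiffOn_seg p u hu)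
  have hXY : partialXY (condKer (s.ker p) (s.left p) (s.right p)) (s.seg p) u v =
      s.cKbar p p u v 1 1 :=
    ((s.hasDerivWithinAt_cKbar p p hu hv 1).congr (fun t ht => hY t ht v hv)
      (hY u hu v hv)).derivWithin (s.uniqueDiffOn_seg p u hu)
  ext i j
  fin_cases i <;> fin_cases j
  · exact s.condKer_eq p u v
  · exact hY u hu v hv
  · exact hX
  · exact hXY

theorem condMeanVec_left (p : Fin K) (x y : Fin 2 → ℝ) :
    s.condMeanVec p x y (s.left p) = x := by
  rw [condMeanVec, lam_left, fromCols_mulVec]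
  simp

theorem condMeanVec_right (p : Fin K) (x y : Fin 2 → ℝ) :
    s.condMeanVec p x y (s.right p) = y := by
  rw [condMeanVec, lam_right, fromCols_mulVec]
  simp

theorem boundaryDensity_eq_chainDensity [NeZero K] (x : Fin (K + 1) → Fin 2 → ℝ) :
    s.boundaryDensity x = chainDensity (s.mVec 0 (s.time 0)) (s.kMat 0 (s.time 0) (s.time 0))
      (fun k x => (s.mVec k (s.right k) - s.bM k *ᵥ s.mVec k (s.left k)) + s.bM k *ᵥ x)
      s.bSigma x := by
  rw [boundaryDensity, chainDensity]
  congr 1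
  refine Finset.prod_congr rfl fun k _ => ?_
  rw [boundaryCov_eq_bSigma, boundaryMean, ← bM, mulVec_sub]
  congr 1
  abel

theorem left_zero [NeZero K] : s.left 0 = s.time 0 := by
  rw [left, Fin.castSucc_zero']

theorem right_zero [NeZero K] : s.right 0 = s.time 1 := by
  rw [right]
  congr 1
  ext
  -- The numeral `1` of `Fin (K + 1)` is `1` modulo `K + 1`, which is `1` because `K` is positive.
  simp [Nat.mod_eq_of_lt (Nat.lt_add_of_pos_left (NeZero.pos K))]

end Params

end StringGP
end

noncomputable section

namespace StringGP

/-! ### Conditional moments -/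

section Conditional

/-- Disintegrating the joint law, the iterated integral of the nonnegative `f` is that of a constant
against a finite measure. Applied to squares, this is the source of the square integrability of the
residuals. -/
theorem integrable_of_condDistrib_integral_eq {Ω α β : Type*} [MeasurableSpace Ω]
    [MeasurableSpace α] [MeasurableSpace β] [StandardBorelSpace β] [Nonempty β] {P : Measure Ω}
    [IsFiniteMeasure P] {X : Ω → α} {Y : Ω → β} (hX : Measurable X) (hY : Measurable Y)
    {f : α × β → ℝ} (hf : Measurable f) (hf0 : ∀ z, 0 ≤ f z) (c : ℝ)
    (hfi : ∀ᵐ x ∂P.map X, Integrable (fun y => f (x, y)) (condDistrib Y X P x) ∧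
      ∫ y, f (x, y) ∂condDistrib Y X P x = c) :
    Integrable (fun ω => f (X ω, Y ω)) P := by
  have h : Integrable f (P.map fun ω => (X ω, Y ω)) := by
    rw [← compProd_map_condDistrib hY.aemeasurable,
      Measure.integrable_compProd_iff hf.aestronglyMeasurable]
    refine ⟨hfi.mono fun x hx => hx.1, (integrable_const c).congr ?_⟩
    filter_upwards [hfi] with x hx
    rw [← hx.2]
    simp only [Real.norm_eq_abs, abs_of_nonneg (hf0 _)]
  exact (integrable_map_measure hf.aestronglyMeasurable (hX.prodMk hY).aemeasurable).1 h

theorem condExp_eq_of_condDistrib_integral_eq {Ω α β : Type*} [MeasurableSpace Ω]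
    [MeasurableSpace α] [MeasurableSpace β] [StandardBorelSpace β] [Nonempty β] {P : Measure Ω}
    [IsFiniteMeasure P] {X : Ω → α} {Y : Ω → β} (hX : Measurable X) (hY : Measurable Y)
    {f : α × β → ℝ} (hf : Measurable f) (hfi : Integrable (fun ω => f (X ω, Y ω)) P) (c : ℝ)
    (hc : ∀ᵐ x ∂P.map X, ∫ y, f (x, y) ∂condDistrib Y X P x = c) :
    P[fun ω => f (X ω, Y ω) | MeasurableSpace.comap X inferInstance] =ᵐ[P] fun _ => c :=
  (condExp_prod_ae_eq_integral_condDistrib hX hY.aemeasurable hf.stronglyMeasurable hfi).trans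
    (ae_of_ae_map hX.aemeasurable hc)

end Conditional

namespace Params

variable {K : ℕ} (s : Params K)

/-- The moments of a product of laws of conditional derivative Gaussian processes. -/
theorem moments_pi {n : ℕ} {t : Fin K → Fin n → ℝ}
    (ht : ∀ k i, t k i ∈ Ioo (s.left k) (s.right k)) {x : Fin (K + 1) → Fin 2 → ℝ}
    {ν : Fin K → Measure (Fin n → Fin 2 → ℝ)}
    (hν : ∀ k, IsDGPLaw
      (condMean (s.mean k) (s.ker k) (s.left k) (s.right k) (x k.castSucc) (x k.succ))
      (condKer (s.ker k) (s.left k) (s.right k)) (s.seg k) (t k) (ν k)) :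
    IsProbabilityMeasure (Measure.pi ν) ∧
    (∀ p a i, MemLp (fun y : Fin K → Fin n → Fin 2 → ℝ => y p a i) 2 (Measure.pi ν)) ∧
    (∀ p a i, ∫ y, y p a i ∂Measure.pi ν =
      s.condMeanVec p (x p.castSucc) (x p.succ) (t p a) i) ∧
    (∀ p q a b i j, cov[fun y => y p a i, fun y => y q b j; Measure.pi ν] =
      s.cKbar p q (t p a) (t q b) i j) := by
  have hseg : ∀ k i, t k i ∈ s.seg k := fun k i => Ioo_subset_Icc_self (ht k i)
  have hG : ∀ k, IsGaussian (ν k) := fun k => (hν k).1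
  have hev : ∀ p, MeasurePreserving (Function.eval p) (Measure.pi ν) (ν p) := fun p =>
    measurePreserving_eval ν p
  have hm : ∀ a i, Measurable fun y : Fin n → Fin 2 → ℝ => y a i := fun a i => by fun_prop
  have hL : ∀ p a i, MemLp (fun y : Fin n → Fin 2 → ℝ => y a i) 2 (ν p) := fun p a i =>
    IsGaussian.memLp_dual (ν p)
      ((ContinuousLinearMap.proj (R := ℝ) (φ := fun _ : Fin 2 => ℝ) i).comp
        (ContinuousLinearMap.proj (R := ℝ) (φ := fun _ : Fin n => Fin 2 → ℝ) a)) 2 (by simp)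
  have hL' : ∀ p a i, MemLp (fun y : Fin K → Fin n → Fin 2 → ℝ => y p a i) 2 (Measure.pi ν) :=
    fun p a i => (hL p a i).comp_measurePreserving (hev p)
  refine ⟨inferInstance, hL', fun p a i => ?_, fun p q a b i j => ?_⟩
  · have h1 := (hν p).2.1 a i
    rw [s.meanVec_condMean p _ _ (hseg p a), ← (hev p).map_eq,
      integral_map (hev p).measurable.aemeasurable (hm a i).aestronglyMeasurable] at h1
    exact h1
  · by_cases hpq : p = q
    · subst hpq
      have h1 := (hν p).2.2 a b i j
      rw [s.kerMat_condKer p (hseg p a) (hseg p b), ← (hev p).map_eq,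
        covariance_map_fun (hm a i).aestronglyMeasurable (hm b j).aestronglyMeasurable
          (hev p).measurable.aemeasurable] at h1
      exact h1
    · rw [s.cKbar_of_ne hpq]
      have hi : iIndepFun (fun (k : Fin K) (y : Fin K → Fin n → Fin 2 → ℝ) => y k)
          (Measure.pi ν) := iIndepFun_pi (X := fun _ y => y) (fun _ => aemeasurable_id)
      exact ((hi.indepFun hpq).comp (hm a i) (hm b j)).covariance_eq_zero (hL' p a i) (hL' q b j)

theorem measurable_condMeanVec (p : Fin K) (u : ℝ) :
    Measurable fun z : (Fin 2 → ℝ) × (Fin 2 → ℝ) => s.condMeanVec p z.1 z.2 u := by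
  refine measurable_const.add ((measurable_mulVec _).comp ?_)
  refine measurable_pi_lambda _ ?_
  rintro (i | i)
  · exact (measurable_pi_apply i).comp (measurable_fst.sub measurable_const)
  · exact (measurable_pi_apply i).comp (measurable_snd.sub measurable_const)

/-! ### Covering of the index interval by the strings and gluing of derivatives. -/

theorem time_mem_dom (k : Fin (K + 1)) : s.time k ∈ s.dom :=
  ⟨s.time_strictMono.monotone (Fin.zero_le k), s.time_strictMono.monotone (Fin.le_last k)⟩

theorem seg_subset_dom (p : Fin K) : s.seg p ⊆ s.dom :=
  Icc_subset_Icc (s.time_mem_dom _).1 (s.time_mem_dom _).2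

theorem exists_mem_seg [NeZero K] {u : ℝ} (hu : u ∈ s.dom) : ∃ p, u ∈ s.seg p := by
  -- Induction on `j` locates a string containing `u`; the exceptional case `u = s.time 0` is
  -- assigned to the first string afterwards.
  have h : ∀ j : Fin (K + 1), u ≤ s.time j → u = s.time 0 ∨ ∃ p, u ∈ s.seg p := by
    intro j
    induction j using Fin.induction with
    | zero => exact fun h => Or.inl (le_antisymm h hu.1)
    | succ j ih =>
      intro h
      rcases le_total u (s.time j.castSucc) with h1 | h1
      · exact ih h1
      · exact Or.inr ⟨j, h1, h⟩
  rcases h (Fin.last K) hu.2 with h | h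
  · exact ⟨0, by rw [h, ← s.left_zero]; exact s.left_mem_seg 0⟩
  · exact h

/-- The punctured neighbourhood filter within a finite union is the supremum of those within the
pieces. A string that misses `u` is closed and contributes the trivial filter. -/
theorem hasDerivWithinAt_dom [NeZero K] {f : ℝ → ℝ} {f' u : ℝ}
    (h : ∀ p, u ∈ s.seg p → HasDerivWithinAt f f' (s.seg p) u) :
    HasDerivWithinAt f f' s.dom u := by
  refine HasDerivWithinAt.mono (t := ⋃ p, s.seg p) ?_ fun v hv => mem_iUnion.2 (s.exists_mem_seg hv)
  rw [hasDerivWithinAt_iff_tendsto_slope, iUnion_sdiff, nhdsWithin_iUnion, Filter.tendsto_iSup]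
  intro p
  by_cases hp : u ∈ s.seg p
  · exact hasDerivWithinAt_iff_tendsto_slope.1 (h p hp)
  · have hc : IsClosed (s.seg p) := isClosed_Icc
    have : nhdsWithin u (s.seg p \ {u}) = ⊥ := by
      rw [← notMem_closure_iff_nhdsWithin_eq_bot]
      exact fun hu => hp (hc.closure_subset_iff.2 sdiff_subset hu)
    rw [this]
    exact Filter.tendsto_bot

end Params

/-! ### Second order structure of a string derivative Gaussian process -/

section Boundary

variable {Ω : Type*} {K : ℕ}

/-- The values at the boundary times. -/
def boundaryValues (s : Params K) (SD : ℝ → Ω → Fin 2 → ℝ) (ω : Ω) (k : Fin (K + 1)) : Fin 2 → ℝ :=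
  SD (s.time k) ω

/-- The σ-algebra generated by the values at all boundary times. -/
@[reducible]
def allBoundarySigma (s : Params K) (SD : ℝ → Ω → Fin 2 → ℝ) : MeasurableSpace Ω :=
  MeasurableSpace.comap (boundaryValues s SD) inferInstance

/-- The deviation of `(z_u, z'_u)` from its conditional mean given the boundary values of the
string `p`. -/
def residual (s : Params K) (SD : ℝ → Ω → Fin 2 → ℝ) (p : Fin K) (u : ℝ) (ω : Ω) : Fin 2 → ℝ :=
  SD u ω - s.condMeanVec p (SD (s.left p) ω) (SD (s.right p) ω) u

end Boundary

theorem Kbar_transpose {Ω : Type*} [MeasurableSpace Ω] {P : Measure Ω} {SD : ℝ → Ω → Fin 2 → ℝ}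
    (u v : ℝ) : (Kbar SD P v u)ᵀ = Kbar SD P u v := by
  ext i j
  exact covariance_comm _ _

section SecondOrder

variable {Ω : Type*} [MeasurableSpace Ω] {P : Measure Ω} [IsProbabilityMeasure P] {K : ℕ}
  [NeZero K] {s : Params K} {SD : ℝ → Ω → Fin 2 → ℝ}

theorem measurable_boundaryValues (hSD : s.IsStringDGP SD P) : Measurable (boundaryValues s SD) :=
  measurable_pi_lambda _ fun k => hSD.measurable _ (s.time_mem_dom k)

theorem hasChainMoments_boundary (hSD : s.IsStringDGP SD P) :
    HasChainMoments (s.kMat 0 (s.time 0) (s.time 0)) s.bM s.bSigma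
      (P.map (boundaryValues s SD)) := by
  have h : P.map (boundaryValues s SD) = chainMeasure (s.mVec 0 (s.time 0))
      (s.kMat 0 (s.time 0) (s.time 0))
      (fun k x => (s.mVec k (s.right k) - s.bM k *ᵥ s.mVec k (s.left k)) + s.bM k *ᵥ x)
      s.bSigma := by
    refine hSD.boundary_law.trans ?_
    simp only [s.boundaryDensity_eq_chainDensity]
    rfl
  rw [h]
  refine hasChainMoments_chainMeasure _ ?_ _ _ _ fun k => ?_
  · rw [← s.left_zero]
    exact s.kMat_left_left_posDef 0
  · rw [← s.boundaryCov_eq_bSigma]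
    exact s.boundaryCov_posDef k

theorem memLp_boundary (hSD : s.IsStringDGP SD P) (k : Fin (K + 1)) (c : Fin 2) :
    MemLp (fun ω => SD (s.time k) ω c) 2 P :=
  (memLp_map_measure_iff (Measurable.aestronglyMeasurable (by fun_prop))
    (measurable_boundaryValues hSD).aemeasurable).1 ((hasChainMoments_boundary hSD).memLp k c)

theorem covariance_boundary (hSD : s.IsStringDGP SD P) (k l : Fin (K + 1)) (i j : Fin 2) :
    cov[fun x => x k i, fun x => x l j; P.map (boundaryValues s SD)] =
      Kbar SD P (s.time k) (s.time l) i j := by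
  have h : ∀ (k : Fin (K + 1)) (c : Fin 2),
      Measurable fun x : Fin (K + 1) → Fin 2 → ℝ => x k c := fun k c => by fun_prop
  exact covariance_map_fun (h k i).aestronglyMeasurable (h l j).aestronglyMeasurable
    (measurable_boundaryValues hSD).aemeasurable

theorem Kbar_zero_zero (hSD : s.IsStringDGP SD P) :
    Kbar SD P (s.time 0) (s.time 0) = s.kMat 0 (s.time 0) (s.time 0) := by
  ext i j
  rw [← covariance_boundary hSD, (hasChainMoments_boundary hSD).cov_zero]

theorem Kbar_succ_of_lt (hSD : s.IsStringDGP SD P) (k : Fin K) (l : Fin (K + 1))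
    (h : l < k.succ) : Kbar SD P (s.time k.succ) (s.time l) =
      s.bM k * Kbar SD P (s.time k.castSucc) (s.time l) := by
  ext i j
  rw [← covariance_boundary hSD, (hasChainMoments_boundary hSD).cov_succ_of_lt k l h, mul_apply]
  simp only [covariance_boundary hSD]

theorem Kbar_succ_succ (hSD : s.IsStringDGP SD P) (k : Fin K) :
    Kbar SD P (s.time k.succ) (s.time k.succ) = s.bSigma k +
      s.bM k * Kbar SD P (s.time k.castSucc) (s.time k.castSucc) * (s.bM k)ᵀ := by
  have h : Kbar SD P (s.time k.succ) (s.time k.succ) = s.bSigma k +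
      s.bM k * Kbar SD P (s.time k.castSucc) (s.time k.succ) := by
    ext i j
    rw [← covariance_boundary hSD, (hasChainMoments_boundary hSD).cov_succ_succ k, Matrix.add_apply,
      mul_apply]
    simp only [covariance_boundary hSD]
  rw [h, ← Kbar_transpose (s.time k.castSucc) (s.time k.succ),
    Kbar_succ_of_lt hSD k _ k.castSucc_lt_succ, transpose_mul, Kbar_transpose, Matrix.mul_assoc]

theorem Kbar_zero_one (hSD : s.IsStringDGP SD P) :
    Kbar SD P (s.time 0) (s.time 1) = s.kMat 0 (s.time 0) (s.time 1) := by
  have h := Kbar_succ_of_lt hSD 0 _ (Fin.castSucc_lt_succ (i := (0 : Fin K)))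
  change Kbar SD P (s.right 0) (s.left 0) = s.bM 0 * Kbar SD P (s.left 0) (s.left 0) at h
  have h0 : Kbar SD P (s.left 0) (s.left 0) = s.kMat 0 (s.left 0) (s.left 0) := by
    rw [s.left_zero, Kbar_zero_zero hSD]
  rw [h0, s.bM_mul_kMat] at h
  rw [← s.left_zero, ← s.right_zero, ← Kbar_transpose, h,
    s.kMat_transpose 0 (s.right_mem_seg 0) (s.left_mem_seg 0)]

theorem Kbar_one_one (hSD : s.IsStringDGP SD P) :
    Kbar SD P (s.time 1) (s.time 1) = s.kMat 0 (s.time 1) (s.time 1) := by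
  have h := Kbar_succ_succ hSD 0
  change Kbar SD P (s.right 0) (s.right 0) =
    s.bSigma 0 + s.bM 0 * Kbar SD P (s.left 0) (s.left 0) * (s.bM 0)ᵀ at h
  have h0 : Kbar SD P (s.left 0) (s.left 0) = s.kMat 0 (s.left 0) (s.left 0) := by
    rw [s.left_zero, Kbar_zero_zero hSD]
  -- With this identity the propagated term is exactly the one subtracted in `bSigma`.
  have h1 : s.kMat 0 (s.left 0) (s.left 0) * (s.bM 0)ᵀ = s.kMat 0 (s.left 0) (s.right 0) := by
    rw [← s.kMat_transpose 0 (s.right_mem_seg 0) (s.left_mem_seg 0), ← s.bM_mul_kMat,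
      transpose_mul, s.kMat_transpose 0 (s.left_mem_seg 0) (s.left_mem_seg 0)]
  rw [h0, Matrix.mul_assoc, h1, Params.bSigma, sub_add_cancel] at h
  rwa [← s.right_zero]

end SecondOrder

end StringGP
end

noncomputable section

namespace StringGP

/-! ### Residuals around the conditional means, and the covariances they determine. -/

section Residual

variable {Ω : Type*} {K : ℕ} {s : Params K} {SD : ℝ → Ω → Fin 2 → ℝ}

theorem residual_left (p : Fin K) (ω : Ω) : residual s SD p (s.left p) ω = 0 := by
  rw [residual, s.condMeanVec_left, sub_self]

theorem residual_right (p : Fin K) (ω : Ω) : residual s SD p (s.right p) ω = 0 := by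
  rw [residual, s.condMeanVec_right, sub_self]

/-- The values at both ends of a string. -/
def endValues (s : Params K) (SD : ℝ → Ω → Fin 2 → ℝ) (p : Fin K) (ω : Ω) : Fin 2 ⊕ Fin 2 → ℝ :=
  Sum.elim (SD (s.left p) ω) (SD (s.right p) ω)

theorem condMeanVec_eq (s : Params K) (SD : ℝ → Ω → Fin 2 → ℝ) (p : Fin K) (u : ℝ) (i : Fin 2)
    (ω : Ω) : s.condMeanVec p (SD (s.left p) ω) (SD (s.right p) ω) u i =
      s.condMeanVec p 0 0 u i + (s.lam p u *ᵥ endValues s SD p ω) i := by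
  have h : Sum.elim (SD (s.left p) ω - s.mVec p (s.left p))
      (SD (s.right p) ω - s.mVec p (s.right p)) =
      Sum.elim (0 - s.mVec p (s.left p)) (0 - s.mVec p (s.right p)) + endValues s SD p ω := by
    ext (c | c) <;> simp [endValues] <;> ring
  simp only [Params.condMeanVec, h, mulVec_add, Pi.add_apply]
  ring

theorem eq_residual_add (s : Params K) (SD : ℝ → Ω → Fin 2 → ℝ) (p : Fin K) (u : ℝ) (i : Fin 2) :
    (fun ω => SD u ω i) = fun ω => s.condMeanVec p 0 0 u i +
      (residual s SD p u ω i + (s.lam p u *ᵥ endValues s SD p ω) i) := by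
  ext ω
  have h := condMeanVec_eq s SD p u i ω
  rw [residual, Pi.sub_apply, h]
  ring

theorem boundarySigma_le_allBoundarySigma (s : Params K) (SD : ℝ → Ω → Fin 2 → ℝ) (p q : Fin K) :
    boundarySigma s SD p q ≤ allBoundarySigma s SD := by
  have h : Measurable fun x : Fin (K + 1) → Fin 2 → ℝ =>
      (x p.castSucc, x p.succ, x q.castSucc, x q.succ) := by fun_prop
  exact (h.comp (comap_measurable (boundaryValues s SD))).comap_le

variable [mΩ : MeasurableSpace Ω] {P : Measure Ω} [IsProbabilityMeasure P] [NeZero K]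

theorem allBoundarySigma_le (hSD : s.IsStringDGP SD P) :
    allBoundarySigma s SD ≤ mΩ :=
  (measurable_boundaryValues hSD).comap_le

/-- For almost all boundary values the conditional law is a product of Gaussian laws whose moments
are known from `moments_pi`. Subtracting the conditional mean leaves first and second moments that
do not depend on the boundary values. -/
theorem residual_moments_of_mem_Ioo (hSD : s.IsStringDGP SD P) {p q : Fin K} {u v : ℝ}
    (hu : u ∈ Ioo (s.left p) (s.right p)) (hv : v ∈ Ioo (s.left q) (s.right q)) (i j : Fin 2) :
    MemLp (fun ω => residual s SD p u ω i) 2 P ∧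
    P[fun ω => residual s SD p u ω i | allBoundarySigma s SD] =ᵐ[P] 0 ∧
    (MemLp (fun ω => residual s SD q v ω j) 2 P →
      P[fun ω => residual s SD p u ω i * residual s SD q v ω j | allBoundarySigma s SD] =ᵐ[P]
        fun _ => s.cKbar p q u v i j) := by
  -- The conditional law wants equally many times in every string: slot `0` carries `u` in the
  -- string `p`, slot `1` carries `v` in the string `q`, and midpoints fill the rest. The case `p =
  -- q` is covered.
  set t : Fin K → Fin 2 → ℝ := fun k => ![if k = p then u else (s.left k + s.right k) / 2,
    if k = q then v else (s.left k + s.right k) / 2] with ht_def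
  have htp : t p 0 = u := by simp [ht_def]
  have htq : t q 1 = v := by simp [ht_def]
  have hmid : ∀ k, (s.left k + s.right k) / 2 ∈ Ioo (s.left k) (s.right k) := fun k => by
    have := s.left_lt_right k
    constructor <;> linarith
  have ht : ∀ k a, t k a ∈ Ioo (s.left k) (s.right k) := by
    intro k a
    fin_cases a
    · by_cases h : k = p
      · subst h; simpa [ht_def] using hu
      · simpa [ht_def, h] using hmid k
    · by_cases h : k = q
      · subst h; simpa [ht_def] using hv
      · simpa [ht_def, h] using hmid k
  have hX := measurable_boundaryValues hSD
  have hY : Measurable fun ω k a => SD (t k a) ω :=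
    measurable_pi_lambda _ fun k => measurable_pi_lambda _ fun a =>
      hSD.measurable _ (s.seg_subset_dom k (Ioo_subset_Icc_self (ht k a)))
  set f : Fin K → Fin 2 → Fin 2 →
      (Fin (K + 1) → Fin 2 → ℝ) × (Fin K → Fin 2 → Fin 2 → ℝ) → ℝ :=
    fun k a c z => z.2 k a c - s.condMeanVec k (z.1 k.castSucc) (z.1 k.succ) (t k a) c with hf_def
  have hf : ∀ k a c, Measurable (f k a c) := fun k a c => by
    have h1 : Measurable fun z : (Fin (K + 1) → Fin 2 → ℝ) × (Fin K → Fin 2 → Fin 2 → ℝ) =>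
        z.2 k a c := by fun_prop
    have h2 : Measurable fun z : (Fin (K + 1) → Fin 2 → ℝ) × (Fin K → Fin 2 → Fin 2 → ℝ) =>
        (z.1 k.castSucc, z.1 k.succ) := by fun_prop
    exact h1.sub ((measurable_pi_apply c).comp ((s.measurable_condMeanVec k (t k a)).comp h2))
  have hlaw : ∀ᵐ x ∂P.map (boundaryValues s SD), ∀ k a c,
      MemLp (fun y => f k a c (x, y)) 2
        (condDistrib (fun ω k a => SD (t k a) ω) (boundaryValues s SD) P x) ∧
      ∫ y, f k a c (x, y)
        ∂(condDistrib (fun ω k a => SD (t k a) ω) (boundaryValues s SD) P x) = 0 ∧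
      ∀ k' a' c', ∫ y, f k a c (x, y) * f k' a' c' (x, y)
        ∂(condDistrib (fun ω k a => SD (t k a) ω) (boundaryValues s SD) P x) =
          s.cKbar k k' (t k a) (t k' a') c c' := by
    filter_upwards [hSD.string_law 2 t ht] with x hx k a c
    obtain ⟨ν, hν, hcd⟩ := hx
    obtain ⟨hprob, hL, hmean, hcov⟩ := s.moments_pi ht hν
    change condDistrib (fun ω k a => SD (t k a) ω) (boundaryValues s SD) P x = _ at hcd
    rw [hcd]
    refine ⟨(hL k a c).sub
      (memLp_const (s.condMeanVec k (x k.castSucc) (x k.succ) (t k a) c)), ?_, fun k' a' c' => ?_⟩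
    · simp only [hf_def]
      rw [integral_sub ((hL k a c).integrable one_le_two) (integrable_const _), hmean]
      simp
    · rw [← hcov, covariance, hmean, hmean]
  have hsq : ∀ k a c, MemLp (fun ω => f k a c (boundaryValues s SD ω, fun k a => SD (t k a) ω))
      2 P := by
    intro k a c
    refine (memLp_two_iff_integrable_sq
      ((hf k a c).comp (hX.prodMk hY)).aestronglyMeasurable).2 ?_
    refine integrable_of_condDistrib_integral_eq (f := fun z => f k a c z ^ 2) hX hY
      ((hf k a c).pow_const 2) (fun z => sq_nonneg _) (s.cKbar k k (t k a) (t k a) c c) ?_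
    filter_upwards [hlaw] with x hx
    refine ⟨(hx k a c).1.integrable_sq, ?_⟩
    rw [← (hx k a c).2.2 k a c]
    simp only [sq]
  have hfp : (fun ω => residual s SD p u ω i) =
      fun ω => f p 0 i (boundaryValues s SD ω, fun k a => SD (t k a) ω) := by
    ext ω
    simp only [hf_def, htp]
    rfl
  have hfq : (fun ω => residual s SD q v ω j) =
      fun ω => f q 1 j (boundaryValues s SD ω, fun k a => SD (t k a) ω) := by
    ext ω
    simp only [hf_def, htq]
    rfl
  refine ⟨hfp ▸ hsq p 0 i, ?_, fun _ => ?_⟩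
  · rw [hfp]
    exact condExp_eq_of_condDistrib_integral_eq hX hY (hf p 0 i)
      ((hsq p 0 i).integrable one_le_two) 0 (hlaw.mono fun x hx => (hx p 0 i).2.1)
  · have hprod : (fun ω => residual s SD p u ω i * residual s SD q v ω j) =
        fun ω => (fun z => f p 0 i z * f q 1 j z)
          (boundaryValues s SD ω, fun k a => SD (t k a) ω) := by
      ext ω
      exact congrArg₂ (· * ·) (congrFun hfp ω) (congrFun hfq ω)
    rw [hprod]
    refine condExp_eq_of_condDistrib_integral_eq hX hY ((hf p 0 i).mul (hf q 1 j))
      ((hsq p 0 i).integrable_mul (hsq q 1 j)) _ ?_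
    filter_upwards [hlaw] with x hx
    rw [← htp, ← htq]
    exact (hx p 0 i).2.2 q 1 j

theorem memLp_residual (hSD : s.IsStringDGP SD P) {p : Fin K} {u : ℝ} (hu : u ∈ s.seg p)
    (i : Fin 2) : MemLp (fun ω => residual s SD p u ω i) 2 P := by
  rcases eq_endpoints_or_mem_Ioo_of_mem_Icc hu with rfl | rfl | h
  · simp only [residual_left]; exact MemLp.zero
  · simp only [residual_right]; exact MemLp.zero
  · exact (residual_moments_of_mem_Ioo hSD h h i i).1

theorem condExp_residual (hSD : s.IsStringDGP SD P) {p : Fin K} {u : ℝ} (hu : u ∈ s.seg p)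
    (i : Fin 2) : P[fun ω => residual s SD p u ω i | allBoundarySigma s SD] =ᵐ[P] 0 := by
  rcases eq_endpoints_or_mem_Ioo_of_mem_Icc hu with rfl | rfl | h
  · simp only [residual_left]; exact (condExp_zero (m := allBoundarySigma s SD)).eventuallyEq
  · simp only [residual_right]; exact (condExp_zero (m := allBoundarySigma s SD)).eventuallyEq
  · exact (residual_moments_of_mem_Ioo hSD h h i i).2.1

theorem condExp_residual_mul (hSD : s.IsStringDGP SD P) {p q : Fin K} {u v : ℝ}
    (hu : u ∈ s.seg p) (hv : v ∈ s.seg q) (i j : Fin 2) :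
    P[fun ω => residual s SD p u ω i * residual s SD q v ω j | allBoundarySigma s SD] =ᵐ[P]
      fun _ => s.cKbar p q u v i j := by
  have h0 : P[fun _ => (0 : ℝ) | allBoundarySigma s SD] =ᵐ[P] fun _ => (0 : ℝ) :=
    (condExp_zero (m := allBoundarySigma s SD)).eventuallyEq
  rcases eq_endpoints_or_mem_Ioo_of_mem_Icc hu with rfl | rfl | h
  · rw [s.cKbar_left p q hv]
    simpa only [residual_left, Pi.zero_apply, Matrix.zero_apply, zero_mul] using h0
  · rw [s.cKbar_right p q hv]
    simpa only [residual_right, Pi.zero_apply, Matrix.zero_apply, zero_mul] using h0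
  · have huT : s.cKbar p q u v i j = s.cKbar q p v u j i := by
      rw [← s.cKbar_transpose p q hu hv, transpose_apply]
    rcases eq_endpoints_or_mem_Ioo_of_mem_Icc hv with rfl | rfl | h'
    · rw [huT, s.cKbar_left q p hu]
      simpa only [residual_left, Pi.zero_apply, Matrix.zero_apply, mul_zero] using h0
    · rw [huT, s.cKbar_right q p hu]
      simpa only [residual_right, Pi.zero_apply, Matrix.zero_apply, mul_zero] using h0
    · exact (residual_moments_of_mem_Ioo hSD h h' i j).2.2 (memLp_residual hSD hv j)

theorem integral_residual (hSD : s.IsStringDGP SD P) {p : Fin K} {u : ℝ} (hu : u ∈ s.seg p)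
    (i : Fin 2) : ∫ ω, residual s SD p u ω i ∂P = 0 := by
  rw [← integral_condExp (allBoundarySigma_le hSD), integral_congr_ae (condExp_residual hSD hu i)]
  simp

theorem covariance_residual (hSD : s.IsStringDGP SD P) {p q : Fin K} {u v : ℝ}
    (hu : u ∈ s.seg p) (hv : v ∈ s.seg q) (i j : Fin 2) :
    cov[fun ω => residual s SD p u ω i, fun ω => residual s SD q v ω j; P] =
      s.cKbar p q u v i j := by
  rw [covariance_eq_sub (memLp_residual hSD hu i) (memLp_residual hSD hv j),
    integral_residual hSD hu, zero_mul, sub_zero, ← integral_condExp (allBoundarySigma_le hSD)]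
  refine (integral_congr_ae (condExp_residual_mul hSD hu hv i j)).trans ?_
  simp

/-- Boundary values are measurable for `allBoundarySigma` and can be pulled out of the conditional
expectation, which vanishes for the residual. -/
theorem covariance_residual_boundary (hSD : s.IsStringDGP SD P) {p : Fin K} {u : ℝ}
    (hu : u ∈ s.seg p) (i : Fin 2) (k : Fin (K + 1)) (c : Fin 2) :
    cov[fun ω => residual s SD p u ω i, fun ω => SD (s.time k) ω c; P] = 0 := by
  have hR := memLp_residual hSD hu i
  have hB := memLp_boundary hSD k c
  have hBm : StronglyMeasurable[allBoundarySigma s SD] fun ω => SD (s.time k) ω c := by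
    have h : Measurable fun x : Fin (K + 1) → Fin 2 → ℝ => x k c := by fun_prop
    exact (h.comp (comap_measurable (boundaryValues s SD))).stronglyMeasurable
  rw [covariance_eq_sub hR hB, integral_residual hSD hu, zero_mul, sub_zero,
    ← integral_condExp (allBoundarySigma_le hSD)]
  have h1 := condExp_mul_of_stronglyMeasurable_right hBm (hR.integrable_mul hB)
    (hR.integrable one_le_two)
  refine (integral_congr_ae (h1.trans ((condExp_residual hSD hu i).mul (ae_eq_refl _)))).trans ?_
  simp

theorem memLp_endValues (hSD : s.IsStringDGP SD P) (p : Fin K) (c : Fin 2 ⊕ Fin 2) :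
    MemLp (fun ω => endValues s SD p ω c) 2 P := by
  rcases c with c | c
  · exact memLp_boundary hSD p.castSucc c
  · exact memLp_boundary hSD p.succ c

theorem memLp_string (hSD : s.IsStringDGP SD P) {p : Fin K} {u : ℝ} (hu : u ∈ s.seg p)
    (i : Fin 2) : MemLp (fun ω => SD u ω i) 2 P := by
  rw [eq_residual_add s SD p u i]
  exact (memLp_const (s.condMeanVec p 0 0 u i)).add
    ((memLp_residual hSD hu i).add (memLp_mulVec _ (memLp_endValues hSD p) i))

theorem covariance_residual_mulVec (hSD : s.IsStringDGP SD P) {p q : Fin K} {u : ℝ}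
    (hu : u ∈ s.seg p) (i j : Fin 2) (A : Matrix (Fin 2) (Fin 2 ⊕ Fin 2) ℝ) :
    cov[fun ω => (A *ᵥ endValues s SD q ω) j, fun ω => residual s SD p u ω i; P] = 0 := by
  rw [covariance_mulVec_left A (memLp_endValues hSD q) (memLp_residual hSD hu i)]
  refine Finset.sum_eq_zero fun c _ => ?_
  rw [covariance_comm]
  rcases c with c | c
  · have h := covariance_residual_boundary hSD hu i q.castSucc c
    exact mul_eq_zero_of_right _ h
  · have h := covariance_residual_boundary hSD hu i q.succ c
    exact mul_eq_zero_of_right _ h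

/-- Both variables are expanded by `eq_residual_add`. Constants drop out, the cross terms vanish by
`covariance_residual_mulVec`, and the residuals give `cKbar` while the end values give the matrix
product. -/
theorem Kbar_string (hSD : s.IsStringDGP SD P) {p q : Fin K} {u v : ℝ}
    (hu : u ∈ s.seg p) (hv : v ∈ s.seg q) :
    Kbar SD P u v = s.cKbar p q u v + s.lam p u *
      Matrix.fromBlocks
        (Kbar SD P (s.left p) (s.left q)) (Kbar SD P (s.left p) (s.right q))
        (Kbar SD P (s.right p) (s.left q)) (Kbar SD P (s.right p) (s.right q)) *
      (s.lam q v)ᵀ := by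
  ext i j
  have hRu := memLp_residual hSD hu i
  have hRv := memLp_residual hSD hv j
  have hLu := memLp_mulVec (s.lam p u) (memLp_endValues hSD p) i
  have hLv := memLp_mulVec (s.lam q v) (memLp_endValues hSD q) j
  have hLL : cov[fun ω => (s.lam p u *ᵥ endValues s SD p ω) i,
      fun ω => (s.lam q v *ᵥ endValues s SD q ω) j; P] = (s.lam p u *
      Matrix.fromBlocks
        (Kbar SD P (s.left p) (s.left q)) (Kbar SD P (s.left p) (s.right q))
        (Kbar SD P (s.right p) (s.left q)) (Kbar SD P (s.right p) (s.right q)) *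
      (s.lam q v)ᵀ) i j := by
    have hB : ∀ c d, cov[fun ω => endValues s SD p ω c, fun ω => endValues s SD q ω d; P] =
      Matrix.fromBlocks
        (Kbar SD P (s.left p) (s.left q)) (Kbar SD P (s.left p) (s.right q))
        (Kbar SD P (s.right p) (s.left q)) (Kbar SD P (s.right p) (s.right q)) c d := by
      rintro (c | c) (d | d) <;> rfl
    rw [covariance_mulVec_left _ (memLp_endValues hSD p) hLv, Matrix.mul_assoc, mul_apply]
    refine Finset.sum_congr rfl fun c _ => ?_
    rw [covariance_comm, covariance_mulVec_left _ (memLp_endValues hSD q) (memLp_endValues hSD p c),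
      mul_apply]
    congr 1
    refine Finset.sum_congr rfl fun d _ => ?_
    rw [covariance_comm, hB, transpose_apply, mul_comm]
  rw [Kbar, of_apply, eq_residual_add s SD p u i, eq_residual_add s SD q v j,
    Matrix.add_apply, ← hLL, ← covariance_residual hSD hu hv i j]
  have h6 := covariance_const_add_left ((hRu.add hLu).integrable one_le_two)
    (s.condMeanVec p 0 0 u i) (Y := fun ω => s.condMeanVec q 0 0 v j +
      (residual s SD q v ω j + (s.lam q v *ᵥ endValues s SD q ω) j))
  have h7 := covariance_const_add_right ((hRv.add hLv).integrable one_le_two)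
    (s.condMeanVec q 0 0 v j) (X := fun ω =>
      residual s SD p u ω i + (s.lam p u *ᵥ endValues s SD p ω) i)
  have h1 := covariance_add_left hRu hLu (hRv.add hLv)
  have h2 := covariance_add_right hRu hRv hLv
  have h3 := covariance_add_right hLu hRv hLv
  have h4 := covariance_residual_mulVec hSD (q := p) hv j i (s.lam p u)
  have h5 := covariance_residual_mulVec hSD (q := q) hu i j (s.lam q v)
  rw [covariance_comm] at h5
  refine (h6.trans (h7.trans h1)).trans ?_
  rw [h2, h3, h4, h5]
  ring

/-! ### Conditional covariances given the boundary values of two strings -/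

/-- The conditional mean given all boundary values depends only on the ends of the string `p`, hence
is already `F`-measurable; the residual has zero conditional expectation given `F` by the tower
property. -/
theorem sub_condExp_eq_residual {Ω : Type*} {F : MeasurableSpace Ω} [mΩ : MeasurableSpace Ω]
    {P : Measure Ω} [IsProbabilityMeasure P] {SD : ℝ → Ω → Fin 2 → ℝ}
    (hSD : s.IsStringDGP SD P) {p : Fin K} (hF : F ≤ allBoundarySigma s SD)
    (hleft : Measurable[F] (SD (s.left p)))
    (hright : Measurable[F] (SD (s.right p))) {u : ℝ} (hu : u ∈ s.seg p) (i : Fin 2) :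
    (fun ω => SD u ω i - (P[fun ω => SD u ω i | F]) ω) =ᵐ[P] fun ω => residual s SD p u ω i := by
  have hle : F ≤ mΩ := hF.trans (allBoundarySigma_le hSD)
  have hR := (memLp_residual hSD hu i).integrable one_le_two
  have hM : Integrable
      (fun ω => s.condMeanVec p (SD (s.left p) ω) (SD (s.right p) ω) u i) P := by
    simp only [condMeanVec_eq]
    exact ((memLp_const (s.condMeanVec p 0 0 u i)).add
      (memLp_mulVec (s.lam p u) (memLp_endValues hSD p) i)).integrable one_le_two
  have hMm : StronglyMeasurable[F]
      (fun ω => s.condMeanVec p (SD (s.left p) ω) (SD (s.right p) ω) u i) :=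
    ((measurable_pi_apply i).comp ((s.measurable_condMeanVec p u).comp
      (hleft.prodMk hright))).stronglyMeasurable
  have hsum : (fun ω => SD u ω i) = (fun ω => residual s SD p u ω i) +
      fun ω => s.condMeanVec p (SD (s.left p) ω) (SD (s.right p) ω) u i := by
    ext ω
    simp [residual]
  have h1 : P[fun ω => residual s SD p u ω i | F] =ᵐ[P] 0 := by
    refine (condExp_condExp_of_le hF (allBoundarySigma_le hSD)).symm.trans ?_
    refine (condExp_congr_ae (condExp_residual hSD hu i)).trans ?_
    rw [condExp_zero]
  have h2 := condExp_add (μ := P) hR hM F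
  rw [condExp_of_stronglyMeasurable hle hMm hM, ← hsum] at h2
  filter_upwards [h1, h2] with ω h3 h4
  rw [h4, Pi.add_apply, h3, residual, Pi.sub_apply]
  simp

theorem condCov_string (hSD : s.IsStringDGP SD P) {p q : Fin K} {u v : ℝ}
    (hu : u ∈ s.seg p) (hv : v ∈ s.seg q) (i j : Fin 2) :
    condCov (boundarySigma s SD p q) (fun ω => SD u ω i) (fun ω => SD v ω j) P =ᵐ[P]
      fun _ => s.cKbar p q u v i j := by
  have hF := boundarySigma_le_allBoundarySigma s SD p q
  have hle := hF.trans (allBoundarySigma_le hSD)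
  have hc : Measurable[boundarySigma s SD p q] fun ω =>
      (SD (s.left p) ω, SD (s.right p) ω, SD (s.left q) ω, SD (s.right q) ω) :=
    comap_measurable _
  have e1 := sub_condExp_eq_residual hSD hF (p := p) hc.fst hc.snd.fst hu i
  have e2 := sub_condExp_eq_residual hSD hF (p := q) hc.snd.snd.fst hc.snd.snd.snd hv j
  refine (condExp_congr_ae (e1.mul e2)).trans ?_
  refine (condExp_condExp_of_le hF (allBoundarySigma_le hSD)).symm.trans ?_
  refine (condExp_congr_ae (condExp_residual_mul hSD hu hv i j)).trans ?_
  rw [condExp_const hle]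

/-! ### Derivatives of the string Gaussian process kernel -/

/-- With `v` fixed in a string `q`, only `cKbar p q x v` and `lam p x` vary with `x`, and the first
row of each differentiates to the second. Every string `p` containing `u` leads to the same value,
an entry of `Kbar`, as the gluing requires. -/
theorem hasDerivWithinAt_Kbar (hSD : s.IsStringDGP SD P) {u v : ℝ}
    (hv : v ∈ s.dom) (j : Fin 2) :
    HasDerivWithinAt (fun x => Kbar SD P x v 0 j) (Kbar SD P u v 1 j) s.dom u := by
  obtain ⟨q, hq⟩ := s.exists_mem_seg hv
  refine s.hasDerivWithinAt_dom fun p hp => ?_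
  refine HasDerivWithinAt.congr (f := fun x => (s.cKbar p q x v + s.lam p x *
      Matrix.fromBlocks
        (Kbar SD P (s.left p) (s.left q)) (Kbar SD P (s.left p) (s.right q))
        (Kbar SD P (s.right p) (s.left q)) (Kbar SD P (s.right p) (s.right q)) *
      (s.lam q v)ᵀ) 0 j) ?_ (fun x hx => by rw [Kbar_string hSD hx hq])
      (by rw [Kbar_string hSD hp hq])
  rw [Kbar_string hSD hp hq]
  exact (s.hasDerivWithinAt_cKbar p q hp hq j).add (Params.hasDerivWithinAt_mul_const
    (fun c => Params.hasDerivWithinAt_mul_const (s.hasDerivWithinAt_lam p hp) _ c) _ j)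

end Residual

end StringGP
end

/-! ### The theorem. -/

theorem mainTheorem3 {Ω : Type*} [MeasurableSpace Ω] (P : Measure Ω) [IsProbabilityMeasure P]
    {K : ℕ} [NeZero K] (s : StringGP.Params K) (SD : ℝ → Ω → Fin 2 → ℝ)
    (hSD : s.IsStringDGP SD P) :
    -- all covariances below are those of square integrable random variables
    (∀ t ∈ s.dom, ∀ c, MemLp (fun ω => SD t ω c) 2 P) ∧
    -- the joint covariance consists of the string GP kernel and its partial derivatives
    (∀ u ∈ s.dom, ∀ v ∈ s.dom,
      StringGP.Kbar SD P u v 0 0 = StringGP.covKer SD P u v ∧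
      HasDerivWithinAt (fun y => StringGP.covKer SD P u y) (StringGP.Kbar SD P u v 0 1) s.dom v ∧
      HasDerivWithinAt (fun x => StringGP.covKer SD P x v) (StringGP.Kbar SD P u v 1 0) s.dom u ∧
      HasDerivWithinAt (fun x => StringGP.partialY (StringGP.covKer SD P) s.dom x v)
        (StringGP.Kbar SD P u v 1 1) s.dom u ∧
      StringGP.Kbar SD P u v = (StringGP.Kbar SD P v u)ᵀ) ∧
    -- the first string
    (StringGP.Kbar SD P (s.time 0) (s.time 0) = s.kMat 0 (s.time 0) (s.time 0) ∧
      StringGP.Kbar SD P (s.time 1) (s.time 1) = s.kMat 0 (s.time 1) (s.time 1) ∧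
      StringGP.Kbar SD P (s.time 0) (s.time 1) = s.kMat 0 (s.time 0) (s.time 1)) ∧
    -- boundary times
    (∀ k : Fin K, StringGP.Kbar SD P (s.time k.succ) (s.time k.succ) =
      s.bSigma k + s.bM k * StringGP.Kbar SD P (s.time k.castSucc) (s.time k.castSucc) *
        (s.bM k)ᵀ) ∧
    (∀ (k : Fin K) (l : Fin (K + 1)), l < k.succ →
      StringGP.Kbar SD P (s.time k.succ) (s.time l) =
        s.bM k * StringGP.Kbar SD P (s.time k.castSucc) (s.time l)) ∧
    -- string times
    (∀ (p q : Fin K), ∀ u ∈ s.seg p, ∀ v ∈ s.seg q,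
      (∀ i j, StringGP.condCov (StringGP.boundarySigma s SD p q) (fun ω => SD u ω i)
        (fun ω => SD v ω j) P =ᵐ[P] fun _ => s.cKbar p q u v i j) ∧
      StringGP.Kbar SD P u v = s.cKbar p q u v + s.lam p u *
        Matrix.fromBlocks
          (StringGP.Kbar SD P (s.left p) (s.left q)) (StringGP.Kbar SD P (s.left p) (s.right q))
          (StringGP.Kbar SD P (s.right p) (s.left q)) (StringGP.Kbar SD P (s.right p) (s.right q)) *
        (s.lam q v)ᵀ) := by
  have hsym : ∀ u v i j, StringGP.Kbar SD P u v i j = StringGP.Kbar SD P v u j i :=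
    fun u v i j => covariance_comm _ _
  have hderiv : ∀ u ∈ s.dom, ∀ v ∈ s.dom, HasDerivWithinAt
      (fun y => StringGP.covKer SD P u y) (StringGP.Kbar SD P u v 0 1) s.dom v := by
    intro u hu v hv
    rw [hsym u v]
    -- The derivative in the second time is the one in the first time with the two arguments
    -- exchanged.
    refine (StringGP.hasDerivWithinAt_Kbar hSD hu 0).congr (fun y _ => ?_) ?_
    · exact hsym u y 0 0
    · exact hsym u v 0 0
  have hud : UniqueDiffOn ℝ s.dom := uniqueDiffOn_Icc (s.time_strictMono (Fin.last_pos' (n := K)))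
  refine ⟨fun t ht c => ?_, fun u hu v hv => ⟨rfl, hderiv u hu v hv,
    StringGP.hasDerivWithinAt_Kbar hSD hv 0, ?_, (StringGP.Kbar_transpose u v).symm⟩,
    ⟨StringGP.Kbar_zero_zero hSD, StringGP.Kbar_one_one hSD, StringGP.Kbar_zero_one hSD⟩,
    StringGP.Kbar_succ_succ hSD, StringGP.Kbar_succ_of_lt hSD,
    fun p q u hu v hv => ⟨StringGP.condCov_string hSD hu hv, StringGP.Kbar_string hSD hu hv⟩⟩
  · obtain ⟨p, hp⟩ := s.exists_mem_seg ht
    exact StringGP.memLp_string hSD hp c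
  -- On the whole index interval `partialY` of the kernel is the entry `(0, 1)` of `Kbar`, so the
  -- mixed derivative comes from the second column.
  · exact (StringGP.hasDerivWithinAt_Kbar hSD hv 1).congr
      (fun x hx => (hderiv x hx v hv).derivWithin (hud v hv))
      ((hderiv u hu v hv).derivWithin (hud v hv))
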